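/- Let $\Omega\subseteq\mathbb Z^d$ be infinite and connected (for the nearest-neighbour graph, in which $m,n$ are joined when $|m-n|=1$), and let $v:\Omega\to\mathbb R$ be arbitrary. Let $$(h_v^\Omega u)(n)=\sum_{m\in\Omega,\ |m-n|=1}u(m)+v(n)u(n),\qquad n\in\Omega,$$ be the discrete Schrödinger operator with Dirichlet boundary conditions, which is self-adjoint in $\ell^2(\Omega)$ on its maximal domain $\{f\in\ell^2(\Omega): h_v^\Omega f\in\ell^2(\Omega)\}$. For $\varphi\in\ell^2(\Omega)$ let $\mu^\varphi$ be the spectral measure of $h_v^\Omega$ at $\varphi$, that is, the finite Borel measure on $\mathbb R$ with $\big((h_v^\Omega-z)^{-1}\varphi,\varphi\big)=\int_{\mathbb R}\frac{d\mu^\varphi(t)}{t-z}$ for all $z\in\mathbb C\setminus\mathbb R$. Let $h^\alpha$ denote $\alpha$-dimensional Hausdorff measure on $\mathbb R$, and let $C_R=\{n\in\mathbb Z^d:|n_i|\le R\text{ for all }i\}$. **Theorem 3.2.** Let $0\le\alpha\le1$ and let $S\subseteq\mathbb R$ be a Borel set with $h^\alpha(S)>0$. Suppose that for every $E\in S$ there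 is a function $u:\Omega\to\mathbb C$, not identically zero, with $h_v^\Omega u=Eu$ on $\Omega$ and $$\liminf_{R\to\infty}R^{-\alpha}\sum_{n\in C_R\cap\Omega}|u(n)|^2<\infty.$$ Then there is a vector $\varphi\in\ell^2(\Omega)$ (regarded as an element of $\ell^2(\mathbb Z^d)$ by extension by zero) such that $\mu^\varphi(S_1)>0$ for every $S_1\subseteq S$ with $h^\alpha(S_1)>0$ (for non-measurable $S_1$, in the sense of outer measures). Moreover, if $\alpha=1$, then for the same $\varphi$ the set $S$ is an essential support of $\nu=\mu^\varphi_{\mathrm{ac}}|_S$, the absolutely continuous part of $\mu^\varphi$ (with respect to Lebesgue measure) restricted to $S$; that is, $\nu(\mathbb R\setminus S)=0$, and every measurable $T\subseteq S$ with $\nu(T)=0$ has Lebesgue measure zero. -/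

import Mathlib

open MeasureTheory Filter Topology
open scoped ENNReal

namespace DiscreteSchrodinger

/-- The lattice `ℤ^d` as a graph: `m` and `n` are joined when their Euclidean distance
`|m - n|` is `1`. -/
def latticeGraph (d : ℕ) : SimpleGraph (Fin d → ℤ) where
  Adj m n := ∑ i, (m i - n i) ^ 2 = 1
  symm := ⟨fun m n h => by
    rw [← h]
    exact Finset.sum_congr rfl fun i _ => by ring⟩
  loopless := ⟨fun m h => by simp at h⟩

/-- The graph induced on a domain `Ω ⊆ ℤ^d`. -/
abbrev domainGraph {d : ℕ} (Ω : Set (Fin d → ℤ)) : SimpleGraph Ω :=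
  (latticeGraph d).induce Ω

theorem finite_neighborSet {d : ℕ} (Ω : Set (Fin d → ℤ)) (n : Ω) :
    ((domainGraph Ω).neighborSet n).Finite := by
  have hbox : (Set.Icc (fun i => n.1 i - 1) (fun i => n.1 i + 1)).Finite := Set.finite_Icc _ _
  refine (hbox.preimage Subtype.val_injective.injOn).subset fun m hm => ?_
  have hm' : ∑ i, (n.1 i - m.1 i) ^ 2 = 1 := hm
  have key : ∀ i, (n.1 i - m.1 i) ^ 2 ≤ 1 := fun i => by
    rw [← hm']
    exact Finset.single_le_sum (f := fun i => (n.1 i - m.1 i) ^ 2)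
      (fun j _ => sq_nonneg _) (Finset.mem_univ i)
  constructor
  · intro i
    have := key i
    show n.1 i - 1 ≤ m.1 i
    nlinarith
  · intro i
    have := key i
    show m.1 i ≤ n.1 i + 1
    nlinarith

noncomputable instance {d : ℕ} (Ω : Set (Fin d → ℤ)) : (domainGraph Ω).LocallyFinite :=
  fun n => (finite_neighborSet Ω n).fintype

/-- The difference expression of the Schrödinger operator on `Ω` with Dirichlet boundary
conditions (points outside `Ω` do not contribute), acting on arbitrary functions on `Ω`:
`(h u)(n) = ∑_{m ∈ Ω, |m - n| = 1} u(m) + v(n) u(n)`. -/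
noncomputable def schrodingerExpr {d : ℕ} (Ω : Set (Fin d → ℤ)) (v : Ω → ℝ) :
    (Ω → ℂ) →ₗ[ℂ] (Ω → ℂ) where
  toFun u n := (∑ m ∈ (domainGraph Ω).neighborFinset n, u m) + (v n : ℂ) * u n
  map_add' u w := by
    funext n
    simp only [Pi.add_apply, Finset.sum_add_distrib]
    ring
  map_smul' c u := by
    funext n
    simp only [Pi.smul_apply, smul_eq_mul, RingHom.id_apply, mul_add, Finset.mul_sum]
    ring

/-- The Hilbert space `ℓ²(Ω)`. -/
abbrev ellTwo {d : ℕ} (Ω : Set (Fin d → ℤ)) : Type := lp (fun _ : Ω => ℂ) 2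

/-- The (possibly unbounded) Schrödinger operator in `ℓ²(Ω)`, on its maximal domain: all
`f ∈ ℓ²(Ω)` with `h f ∈ ℓ²(Ω)`. Since the sum over neighbours is a bounded symmetric operator
and `v` is real, this is the self-adjoint realization of the expression. -/
noncomputable def schrodingerOp {d : ℕ} (Ω : Set (Fin d → ℤ)) (v : Ω → ℝ) :
    ellTwo Ω →ₗ.[ℂ] ellTwo Ω where
  domain :=
    { carrier := {f | Memℓp (schrodingerExpr Ω v f) 2}
      zero_mem' := by
        show Memℓp (schrodingerExpr Ω v ((0 : ellTwo Ω) : Ω → ℂ)) 2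
        rw [lp.coeFn_zero, map_zero]
        exact zero_memℓp
      add_mem' := fun {f g} hf hg => by
        show Memℓp (schrodingerExpr Ω v ((f + g : ellTwo Ω) : Ω → ℂ)) 2
        rw [lp.coeFn_add, map_add]
        exact Memℓp.add hf hg
      smul_mem' := fun c f hf => by
        show Memℓp (schrodingerExpr Ω v ((c • f : ellTwo Ω) : Ω → ℂ)) 2
        rw [lp.coeFn_smul, map_smul]
        exact Memℓp.const_smul hf c }
  toFun :=
    { toFun := fun f => ⟨schrodingerExpr Ω v f.1, f.2⟩
      map_add' := fun f g => by
        apply Subtype.ext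
        show schrodingerExpr Ω v ((f.1 + g.1 : ellTwo Ω) : Ω → ℂ) = _
        rw [lp.coeFn_add, map_add]
        rfl
      map_smul' := fun c f => by
        apply Subtype.ext
        show schrodingerExpr Ω v ((c • f.1 : ellTwo Ω) : Ω → ℂ) = _
        rw [lp.coeFn_smul, map_smul]
        rfl }

/-- `μ` is the spectral measure of the self-adjoint operator `A` at the vector `φ`: the (unique)
finite Borel measure on `ℝ` whose Borel transform is
`((A - z)⁻¹ φ, φ) = ∫ dμ(t) / (t - z)` for all non-real `z`.
Here `ψ = (A - z)⁻¹ φ`, and Mathlib's `inner` is conjugate-linear in its first argument. -/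
def IsSpectralMeasure {H : Type*} [NormedAddCommGroup H] [InnerProductSpace ℂ H]
    (A : H →ₗ.[ℂ] H) (φ : H) (μ : Measure ℝ) : Prop :=
  IsFiniteMeasure μ ∧
    ∀ z : ℂ, z.im ≠ 0 → ∃ ψ : A.domain,
      A ψ - z • (ψ : H) = φ ∧ inner ℂ φ (ψ : H) = ∫ t : ℝ, ((t : ℂ) - z)⁻¹ ∂μ

/-- `u` is a nontrivial solution on `Ω` of `(h - E) u = 0` with Dirichlet boundary conditions;
`u` is not required to be square summable. -/
def IsNontrivialSolution {d : ℕ} (Ω : Set (Fin d → ℤ)) (v : Ω → ℝ) (E : ℝ) (u : Ω → ℂ) : Prop :=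
  u ≠ 0 ∧ schrodingerExpr Ω v u = (E : ℂ) • u

/-- The mass `∑_{n ∈ C_R ∩ Ω} |u(n)|²`, where `C_R = {n : |n_i| ≤ R for all i}`. -/
noncomputable def cubeMass {d : ℕ} (Ω : Set (Fin d → ℤ)) (u : Ω → ℂ) (R : ℝ) : ℝ≥0∞ :=
  ∑' n : {n : Ω // ∀ i, |((n : Fin d → ℤ) i : ℝ)| ≤ R}, ‖u n‖ₑ ^ 2

/-- The growth condition `liminf_{R → ∞} R^{-α} ∑_{n ∈ C_R ∩ Ω} |u(n)|² < ∞`. -/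
def HasSlowGrowth {d : ℕ} (Ω : Set (Fin d → ℤ)) (α : ℝ) (u : Ω → ℂ) : Prop :=
  liminf (fun R : ℝ => ENNReal.ofReal (R ^ (-α)) * cubeMass Ω u R) atTop < ∞

/-- The absolutely continuous part, with respect to Lebesgue measure, in the Lebesgue
decomposition of `μ`. -/
noncomputable def acPart (μ : Measure ℝ) : Measure ℝ :=
  (volume : Measure ℝ).withDensity (μ.rnDeriv volume)

/-- `S` is an essential support of the (absolutely continuous) measure `ν`: `ν` lives on `S`, and
every measurable subset of `S` that is `ν`-null has Lebesgue measure zero. This determines `S` up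
to sets of Lebesgue measure zero. -/
def IsEssentialSupport (ν : Measure ℝ) (S : Set ℝ) : Prop :=
  ν Sᶜ = 0 ∧ ∀ T : Set ℝ, MeasurableSet T → T ⊆ S → ν T = 0 → volume T = 0

end DiscreteSchrodinger

/-! Fix `E ∈ S`, a slowly growing solution `u`, and a site `n` with `u n ≠ 0`. Cutting `u` off
linearly on the cube of side of order `k` gives an ℓ² vector that solves the equation up to an error
of order `1/k` times the norm of `u` on that cube. Pairing it with the resolvent applied to `δ_n` at
`z = E + i/k` bounds `k ^ (α - 2) * ‖(h - z)⁻¹ δ_n‖ ^ 2` below by a positive constant for infinitely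
many `k` (`resolvent_lower_bound`). Call a vector with this property large at `E`.

By the spectral theorem, `‖(h - z)⁻¹ ψ‖ ^ 2` is the integral of `|t - z|⁻²` against the spectral
measure of `ψ`. Largeness at `E` therefore gives that measure positive upper `α`-density at `E`, and
a Vitali covering argument shows that a null set of the measure consisting of such points is
`h^α`-null (`hausdorffMeasure_eq_zero_of_poisson`).

The site `n` depends on `E`, so a single vector must replace all the `δ_n`. Take a sum of the `δ_n`
with positive summable weights and random phases. The vectors not large at a given `E` form a
subspace. If `δ_n` is large at `E`, then two sums differing only in the phase at `n` cannot both be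
non-large, so almost every choice of phases is large at `E`. Fubini yields one `φ` such that, for
each `n`, the points where `δ_n` is large and `φ` is not are null for the spectral measure of `δ_n`
(`exists_generic_vector`). They are then `h^α`-null, so `φ` is large at `h^α`-almost every point of
`S`, and the density argument applies to `φ` itself. -/

namespace DiscreteSchrodinger

/-! ### Spectral measures of an unbounded operator from one bounded normal resolvent. -/

section SpectralMeasure

/-- A positive functional on the continuous functions on a compact space is represented by a
finite measure. -/
theorem exists_finite_measure_of_positive {X : Type*} [TopologicalSpace X] [CompactSpace X]
    [T2Space X] [MeasurableSpace X] [BorelSpace X] (Λ : C(X, ℝ) →ₗ[ℝ] ℝ)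
    (hΛ : ∀ f : C(X, ℝ), 0 ≤ f → 0 ≤ Λ f) :
    ∃ ρ : Measure X, IsFiniteMeasure ρ ∧ ∀ f : C(X, ℝ), ∫ x, f x ∂ρ = Λ f := by
  let L : CompactlySupportedContinuousMap X ℝ →ₗ[ℝ] ℝ :=
    { toFun := fun f => Λ f.toContinuousMap
      map_add' := fun f g => Λ.map_add _ _
      map_smul' := fun c f => Λ.map_smul c _ }
  let P : CompactlySupportedContinuousMap X ℝ →ₚ[ℝ] ℝ :=
    PositiveLinearMap.mk₀ L fun f hf => hΛ _ fun x => hf x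
  have hreg : (RealRMK.rieszMeasure P).Regular := by
    unfold RealRMK.rieszMeasure
    infer_instance
  refine ⟨RealRMK.rieszMeasure P, inferInstance, fun f => ?_⟩
  exact RealRMK.integral_rieszMeasure P (CompactlySupportedContinuousMap.continuousMapEquiv f)

variable {H : Type*} [NormedAddCommGroup H] [InnerProductSpace ℂ H] [CompleteSpace H]

/-- Spectral measures of a bounded normal operator. -/
theorem exists_spectralMeasure_of_isStarNormal (R : H →L[ℂ] H) (hR : IsStarNormal R) (φ : H) :
    ∃ ρ : Measure (spectrum ℂ R), IsFiniteMeasure ρ ∧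
      ∀ f : C(spectrum ℂ R, ℂ), inner ℂ φ (cfcHom hR f φ) = ∫ x, f x ∂ρ := by
  let ofR : C(spectrum ℂ R, ℝ) → C(spectrum ℂ R, ℂ) := fun f =>
    ⟨fun x => (f x : ℂ), Complex.continuous_ofReal.comp f.continuous⟩
  let Λ : C(spectrum ℂ R, ℝ) →ₗ[ℝ] ℝ :=
    { toFun := fun f => (inner ℂ φ (cfcHom hR (ofR f) φ)).re
      map_add' := fun f g => by
        have : ofR (f + g) = ofR f + ofR g := by ext; simp [ofR]
        rw [this, map_add, add_apply, inner_add_right, Complex.add_re]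
      map_smul' := fun c f => by
        have : ofR (c • f) = (c : ℂ) • ofR f := by ext; simp [ofR]
        rw [this, map_smul, smul_apply, inner_smul_right]
        simp }
  have hpos : ∀ f : C(spectrum ℂ R, ℝ), 0 ≤ f → 0 ≤ Λ f := fun f hf => by
    let g : C(spectrum ℂ R, ℝ) := ⟨fun x => Real.sqrt (f x), f.continuous.sqrt⟩
    have hg : ofR f = star (ofR g) * ofR g := by
      ext x
      have : Real.sqrt (f x) * Real.sqrt (f x) = f x := Real.mul_self_sqrt (hf x)
      simp only [ofR, g, ContinuousMap.coe_mk, ContinuousMap.mul_apply, ContinuousMap.star_apply,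
        RCLike.star_def, Complex.conj_ofReal, ← Complex.ofReal_mul]
      rw [this]
    show 0 ≤ (inner ℂ φ (cfcHom hR (ofR f) φ)).re
    rw [hg, map_mul, map_star, mul_apply_eq_comp, ContinuousLinearMap.star_eq_adjoint,
      ContinuousLinearMap.adjoint_inner_right]
    exact inner_self_nonneg (𝕜 := ℂ)
  obtain ⟨ρ, hρ, hint⟩ := exists_finite_measure_of_positive Λ hpos
  refine ⟨ρ, hρ, fun f => ?_⟩
  -- Real functions give self-adjoint operators, whose quadratic forms have no imaginary part, so
  -- the real functional `Λ` already determines everything.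
  have hreal : ∀ g : C(spectrum ℂ R, ℝ),
      inner ℂ φ (cfcHom hR (ofR g) φ) = ((∫ x, g x ∂ρ : ℝ) : ℂ) := fun g => by
    rw [hint g]
    have hsa : star (cfcHom hR (ofR g)) = cfcHom hR (ofR g) := by
      rw [← map_star]
      congr 1
      ext x
      simp [ofR]
    apply Complex.ext
    · simp [Λ]
    · have h : (starRingEnd ℂ) (inner ℂ φ (cfcHom hR (ofR g) φ)) =
          inner ℂ φ (cfcHom hR (ofR g) φ) := by
        rw [inner_conj_symm]
        conv_rhs => rw [← hsa, ContinuousLinearMap.star_eq_adjoint,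
          ContinuousLinearMap.adjoint_inner_right]
      rw [Complex.conj_eq_iff_im.mp h, Complex.ofReal_im]
  let g₁ : C(spectrum ℂ R, ℝ) := ⟨fun x => (f x).re, Complex.continuous_re.comp f.continuous⟩
  let g₂ : C(spectrum ℂ R, ℝ) := ⟨fun x => (f x).im, Complex.continuous_im.comp f.continuous⟩
  have hf : f = ofR g₁ + Complex.I • ofR g₂ := by
    ext x
    simp [ofR, g₁, g₂, mul_comm Complex.I]
  have hi : Integrable (fun x => f x) ρ := by
    have := f.continuous.integrable_of_hasCompactSupport (μ := ρ)
      (HasCompactSupport.of_compactSpace _)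
    exact this
  conv_lhs => rw [hf]
  rw [map_add, map_smul, add_apply, smul_apply,
    inner_add_right, inner_smul_right, hreal, hreal]
  have h := integral_re_add_im (𝕜 := ℂ) hi
  rw [← h]
  simp [g₁, g₂, mul_comm Complex.I]

/-- The resolvent at `z`, expressed through the resolvent `R` at `iK`. -/
noncomputable def resolventAt (R : H →L[ℂ] H) (K : ℝ) (z : ℂ) : H →L[ℂ] H :=
  R * Ring.inverse (1 - (z - Complex.I * K) • R)

/-- `R` satisfies the first resolvent identities between the points `iK` and `-iK`. -/
structure IsResolventAtI (R : H →L[ℂ] H) (K : ℝ) : Prop where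
  sub_star : R - star R = (2 * Complex.I * K) • (star R * R)
  sub_star' : R - star R = (2 * Complex.I * K) • (R * star R)
  pos : 0 < K

variable {R : H →L[ℂ] H} {K : ℝ}

theorem IsResolventAtI.isStarNormal (h : IsResolventAtI R K) : IsStarNormal R := by
  constructor
  have h' := h.sub_star.symm.trans h.sub_star'
  have hK : (2 * Complex.I * K) ≠ 0 := by
    simp [h.pos.ne']
  exact smul_right_injective _ hK h'

/-- The functional calculus turns the resolvent identity for `R` into the same identity for numbers.
For `x ≠ 0` it says that `x⁻¹ + iK` is real: the spectrum lies on a circle through `0`. -/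
theorem IsResolventAtI.spectrum_eq (h : IsResolventAtI R K) {x : ℂ} (hx : x ∈ spectrum ℂ R) :
    x - (starRingEnd ℂ) x = (2 * Complex.I * K) * ((starRingEnd ℂ) x * x) := by
  have hR := h.isStarNormal
  have h1 : cfc (fun x : ℂ => x - star x) R = cfc (fun x : ℂ => (2 * Complex.I * K) * (star x * x)) R := by
    rw [cfc_sub _ _ R, cfc_const_mul _ _ R, cfc_mul _ _ R, cfc_star_id R, cfc_id' ℂ R]
    exact h.sub_star
  have h2 := (cfc_eq_cfc_iff_eqOn (p := IsStarNormal) (R := ℂ) (a := R)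
    (f := fun x : ℂ => x - star x)
    (g := fun x : ℂ => (2 * Complex.I * K) * (star x * x))).mp h1
  exact h2 hx

/-- Vanishing would mean `z = x⁻¹ + iK`, which is real on the circle. -/
theorem one_sub_ne_zero_of_circle {x z : ℂ} (hz : z.im ≠ 0)
    (hx : x - (starRingEnd ℂ) x = (2 * Complex.I * K) * ((starRingEnd ℂ) x * x)) :
    1 - (z - Complex.I * K) * x ≠ 0 := by
  intro h0
  have h1 : (z - Complex.I * K) * x = 1 := (sub_eq_zero.mp h0).symm
  have h2 : ((starRingEnd ℂ) z + Complex.I * K) * (starRingEnd ℂ) x = 1 := by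
    have := congrArg (starRingEnd ℂ) h1
    simpa using this
  have h3 : (starRingEnd ℂ) z - z = 0 := by
    have e : ((z - Complex.I * K) * ((starRingEnd ℂ) z + Complex.I * K)) *
        (x - (starRingEnd ℂ) x) = ((z - Complex.I * K) * ((starRingEnd ℂ) z + Complex.I * K)) *
        ((2 * Complex.I * K) * ((starRingEnd ℂ) x * x)) := by rw [hx]
    linear_combination e - ((starRingEnd ℂ) z + Complex.I * K) * h1 + (z - Complex.I * K) * h2
      + (2 * Complex.I * K) * ((starRingEnd ℂ) z + Complex.I * K) * (starRingEnd ℂ) x * h1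
      + (2 * Complex.I * K) * h2
  apply hz
  exact Complex.conj_eq_iff_im.mp (sub_eq_zero.mp h3)

theorem IsResolventAtI.isUnit (h : IsResolventAtI R K) {z : ℂ} (hz : z.im ≠ 0) :
    IsUnit (1 - (z - Complex.I * K) • R) := by
  have hR := h.isStarNormal
  have h1 : cfc (fun x : ℂ => 1 - (z - Complex.I * K) * x) R = 1 - (z - Complex.I * K) • R := by
    rw [cfc_sub _ _ R, cfc_const_mul _ _ R, cfc_id' ℂ R, cfc_const_one ℂ R]
  rw [← h1]
  rw [isUnit_cfc_iff (p := IsStarNormal) (fun x : ℂ => 1 - (z - Complex.I * K) * x) R]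
  exact fun x hx => one_sub_ne_zero_of_circle hz (h.spectrum_eq hx)

theorem IsResolventAtI.continuousOn (h : IsResolventAtI R K) {z : ℂ} (hz : z.im ≠ 0) :
    ContinuousOn (fun x : ℂ => x / (1 - (z - Complex.I * K) * x)) (spectrum ℂ R) :=
  continuousOn_id.div (by fun_prop) fun x hx => one_sub_ne_zero_of_circle hz (h.spectrum_eq hx)

theorem IsResolventAtI.resolventAt_eq_cfc (h : IsResolventAtI R K) {z : ℂ} (hz : z.im ≠ 0) :
    resolventAt R K z = cfc (fun x : ℂ => x / (1 - (z - Complex.I * K) * x)) R := by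
  have hR := h.isStarNormal
  have hu := h.isUnit hz
  have hc := h.continuousOn hz
  have h1 : cfc (fun x : ℂ => 1 - (z - Complex.I * K) * x) R = 1 - (z - Complex.I * K) • R := by
    rw [cfc_sub _ _ R, cfc_const_mul _ _ R, cfc_id' ℂ R, cfc_const_one ℂ R]
  have h2 : cfc (fun x : ℂ => x / (1 - (z - Complex.I * K) * x)) R *
      (1 - (z - Complex.I * K) • R) = R := by
    rw [← h1, ← cfc_mul _ _ R hc (by fun_prop)]
    conv_rhs => rw [← cfc_id' ℂ R]
    apply cfc_congr
    intro x hx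
    exact div_mul_cancel₀ _ (one_sub_ne_zero_of_circle hz (h.spectrum_eq hx))
  unfold resolventAt
  nth_rewrite 1 [← h2]
  rw [mul_assoc, Ring.mul_inverse_cancel _ hu, mul_one]

theorem IsResolventAtI.resolventAt_apply (h : IsResolventAtI R K) {z : ℂ} (hz : z.im ≠ 0) (φ : H) :
    ∃ χ : H, resolventAt R K z φ = R χ ∧ χ = φ + (z - Complex.I * K) • resolventAt R K z φ := by
  refine ⟨Ring.inverse (1 - (z - Complex.I * K) • R) φ, rfl, ?_⟩
  have := congrArg (fun A : H →L[ℂ] H => A φ) (Ring.mul_inverse_cancel _ (h.isUnit hz))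
  simp only [mul_apply_eq_comp, sub_apply,
    one_apply_eq_self, smul_apply] at this
  rw [sub_eq_iff_eq_add] at this
  exact this

theorem IsResolventAtI.continuousAt (h : IsResolventAtI R K) {z : ℂ} (hz : z.im ≠ 0) :
    ContinuousAt (resolventAt R K) z := by
  unfold resolventAt
  obtain ⟨u, hu⟩ := h.isUnit hz
  have h1 : ContinuousAt (Ring.inverse : (H →L[ℂ] H) → (H →L[ℂ] H))
      (1 - (z - Complex.I * K) • R) := by
    rw [← hu]
    exact NormedRing.inverse_continuousAt u
  have h2 : ContinuousAt (fun z : ℂ => 1 - (z - Complex.I * K) • R) z := by fun_prop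
  exact continuousAt_const.mul (ContinuousAt.comp (f := fun z : ℂ => 1 - (z - Complex.I * K) • R) h1 h2)

theorem inv_sub_eq_of_circle {x z : ℂ} (hz : z.im ≠ 0)
    (hx : x - (starRingEnd ℂ) x = (2 * Complex.I * K) * ((starRingEnd ℂ) x * x)) (hx0 : x ≠ 0) :
    (((x⁻¹ + Complex.I * K).re : ℂ) - z)⁻¹ = x / (1 - (z - Complex.I * K) * x) := by
  have hx0' : (starRingEnd ℂ) x ≠ 0 := by simpa using hx0
  have h1 : ((x⁻¹ + Complex.I * K).re : ℂ) = x⁻¹ + Complex.I * K := by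
    rw [← Complex.conj_eq_iff_re]
    simp only [map_add, map_inv₀, map_mul, Complex.conj_I, Complex.conj_ofReal]
    field_simp
    linear_combination hx
  rw [h1]
  have h2 := one_sub_ne_zero_of_circle hz hx
  rw [inv_eq_iff_eq_inv, inv_div]
  field_simp
  ring

/-- Existence of the spectral measure of the self-adjoint operator with resolvent `R` at `iK`. -/
theorem IsResolventAtI.exists_measure (h : IsResolventAtI R K) (φ : H) :
    ∃ μ : Measure ℝ, IsFiniteMeasure μ ∧ ∀ z : ℂ, z.im ≠ 0 →
      inner ℂ φ (resolventAt R K z φ) = ∫ t : ℝ, ((t : ℂ) - z)⁻¹ ∂μ ∧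
      ‖resolventAt R K z φ‖ ^ 2 = ∫ t : ℝ, ‖((t : ℂ) - z)⁻¹‖ ^ 2 ∂μ := by
  have hR := h.isStarNormal
  obtain ⟨ρ, hρ, hint⟩ := exists_spectralMeasure_of_isStarNormal R hR φ
  -- This undoes `x = (t - iK)⁻¹`. The point `x = 0` corresponds to `t = ∞` and may lie in the
  -- spectrum; it is removed, at no cost because the functions `F` below vanish there.
  let g : spectrum ℂ R → ℝ := fun x => ((x : ℂ)⁻¹ + Complex.I * K).re
  have hg : Measurable g := by
    refine Complex.measurable_re.comp ?_
    exact (measurable_subtype_coe.inv).add_const _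
  have hZ : MeasurableSet {x : spectrum ℂ R | (x : ℂ) ≠ 0} :=
    (measurable_subtype_coe (measurableSet_singleton (0 : ℂ))).compl
  refine ⟨Measure.map g (ρ.restrict {x | (x : ℂ) ≠ 0}), inferInstance, fun z hz => ?_⟩
  let F : C(spectrum ℂ R, ℂ) := ⟨fun x => x / (1 - (z - Complex.I * K) * x),
    (h.continuousOn hz).domRestrict⟩
  have hF : resolventAt R K z = cfcHom hR F := by
    rw [h.resolventAt_eq_cfc hz, cfc_apply _ R hR (h.continuousOn hz)]
    rfl
  have hmeas : Measurable fun t : ℝ => ((t : ℂ) - z)⁻¹ :=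
    (Complex.measurable_ofReal.sub_const z).inv
  have key : ∀ x : spectrum ℂ R, (x : ℂ) ≠ 0 → ((g x : ℂ) - z)⁻¹ = F x := fun x hx =>
    inv_sub_eq_of_circle hz (h.spectrum_eq x.2) hx
  have key0 : ∀ x : spectrum ℂ R, x ∉ {x : spectrum ℂ R | (x : ℂ) ≠ 0} → F x = 0 := fun x hx => by
    have : (x : ℂ) = 0 := by simpa using hx
    show (x : ℂ) / _ = 0
    rw [this, zero_div]
  constructor
  · rw [integral_map hg.aemeasurable hmeas.aestronglyMeasurable, hF, hint F]
    rw [setIntegral_congr_fun hZ (fun x hx => key x hx)]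
    exact (setIntegral_eq_integral_of_forall_compl_eq_zero key0).symm
  · rw [integral_map hg.aemeasurable (hmeas.norm.pow_const 2).aestronglyMeasurable]
    rw [setIntegral_congr_fun (g := fun x => ‖F x‖ ^ 2) hZ
      (fun x hx => by simp only; rw [key x hx])]
    rw [setIntegral_eq_integral_of_forall_compl_eq_zero (fun x hx => by rw [key0 x hx]; simp)]
    -- The squared norm of `F(R) φ` is the quadratic form of `star F * F` at `φ`.
    have h1 := hint (star F * F)
    rw [map_mul, map_star, mul_apply_eq_comp, ContinuousLinearMap.star_eq_adjoint,
      ContinuousLinearMap.adjoint_inner_right, ← hF, inner_self_eq_norm_sq_to_K] at h1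
    have h2 : ∀ x, (star F * F) x = ((‖F x‖ ^ 2 : ℝ) : ℂ) := fun x => by
      simp only [ContinuousMap.mul_apply, ContinuousMap.star_apply, RCLike.star_def]
      rw [Complex.conj_mul']
      norm_cast
    simp_rw [h2] at h1
    rw [integral_complex_ofReal] at h1
    apply Complex.ofReal_injective
    rw [Complex.ofReal_pow]
    exact h1

end SpectralMeasure

/-! ### The Schrödinger operator as a bounded perturbation of multiplication by `v`, and its
resolvent. -/

section Operators

variable {d : ℕ} (Ω : Set (Fin d → ℤ))

theorem schrodingerExpr_apply (v : Ω → ℝ) (u : Ω → ℂ) (n : Ω) :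
    schrodingerExpr Ω v u n =
      (∑ m ∈ (domainGraph Ω).neighborFinset n, u m) + (v n : ℂ) * u n := rfl

theorem schrodingerExpr_zero_apply (u : Ω → ℂ) (n : Ω) :
    schrodingerExpr Ω 0 u n = ∑ m ∈ (domainGraph Ω).neighborFinset n, u m := by
  simp [schrodingerExpr_apply]

theorem schrodingerExpr_eq_add (v : Ω → ℝ) (u : Ω → ℂ) (n : Ω) :
    schrodingerExpr Ω v u n = schrodingerExpr Ω 0 u n + (v n : ℂ) * u n := by
  rw [schrodingerExpr_zero_apply, schrodingerExpr_apply]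

theorem abs_sub_le_one_of_adj {n m : Ω} (h : (domainGraph Ω).Adj n m) (i : Fin d) :
    |n.1 i - m.1 i| ≤ 1 := by
  have h' : ∑ i, (n.1 i - m.1 i) ^ 2 = 1 := h
  have key : (n.1 i - m.1 i) ^ 2 ≤ 1 := by
    rw [← h']
    exact Finset.single_le_sum (f := fun i => (n.1 i - m.1 i) ^ 2)
      (fun j _ => sq_nonneg _) (Finset.mem_univ i)
  exact abs_le_one_iff_mul_self_le_one.mpr (by rw [← sq]; exact key)

theorem card_neighborFinset_le (n : Ω) : ((domainGraph Ω).neighborFinset n).card ≤ 3 ^ d := by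
  have h : ((domainGraph Ω).neighborFinset n).image Subtype.val ⊆
      Finset.Icc (fun i => n.1 i - 1) (fun i => n.1 i + 1) := by
    intro m hm
    obtain ⟨m', hm', rfl⟩ := Finset.mem_image.mp hm
    rw [SimpleGraph.mem_neighborFinset] at hm'
    have := fun i => abs_le.mp (abs_sub_le_one_of_adj Ω hm' i)
    rw [Finset.mem_Icc]
    exact ⟨fun i => by have := this i; simp only; omega,
      fun i => by have := this i; simp only; omega⟩
  have h2 := Finset.card_le_card h
  rw [Finset.card_image_of_injective _ Subtype.val_injective, Pi.card_Icc] at h2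
  refine h2.trans (le_of_eq ?_)
  rw [Finset.prod_congr rfl (g := fun _ => 3), Finset.prod_const, Finset.card_univ,
    Fintype.card_fin]
  intro i _
  rw [Int.card_Icc]
  omega

/-- Cauchy–Schwarz over the neighbours of `n`, then exchange of the double sum; each step costs one
degree bound. The crude bound `3 ^ d` is enough, since only boundedness is needed. -/
theorem sum_norm_sq_adj_le (f : ellTwo Ω) (s : Finset Ω) :
    ∑ n ∈ s, ‖schrodingerExpr Ω 0 f n‖ ^ 2 ≤ ((3 ^ d : ℝ) * ‖f‖) ^ 2 := by
  classical
  have hcard : ∀ n, (((domainGraph Ω).neighborFinset n).card : ℝ) ≤ 3 ^ d := fun n => by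
    exact_mod_cast card_neighborFinset_le Ω n
  have h1 : ∀ n ∈ s, ‖schrodingerExpr Ω 0 f n‖ ^ 2 ≤
      (3 ^ d : ℝ) * ∑ m ∈ (domainGraph Ω).neighborFinset n, ‖f m‖ ^ 2 := fun n _ => by
    rw [schrodingerExpr_zero_apply]
    calc ‖∑ m ∈ (domainGraph Ω).neighborFinset n, f m‖ ^ 2
        ≤ (∑ m ∈ (domainGraph Ω).neighborFinset n, ‖f m‖) ^ 2 := by
          gcongr
          exact norm_sum_le _ _
      _ ≤ _ := sq_sum_le_card_mul_sum_sq
      _ ≤ _ := by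
          gcongr
          exact hcard n
  have h2 : ∑ n ∈ s, ∑ m ∈ (domainGraph Ω).neighborFinset n, ‖f m‖ ^ 2 =
      ∑ m ∈ s.biUnion fun n => (domainGraph Ω).neighborFinset n,
        ∑ n ∈ s.filter (fun n => (domainGraph Ω).Adj n m), ‖f m‖ ^ 2 := by
    apply Finset.sum_comm'
    intro x y
    simp only [SimpleGraph.mem_neighborFinset, Finset.mem_filter, Finset.mem_biUnion]
    constructor
    · rintro ⟨h1, h2⟩
      exact ⟨⟨h1, h2⟩, x, h1, h2⟩
    · rintro ⟨h, -⟩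
      exact h
  calc ∑ n ∈ s, ‖schrodingerExpr Ω 0 f n‖ ^ 2
      ≤ ∑ n ∈ s, (3 ^ d : ℝ) * ∑ m ∈ (domainGraph Ω).neighborFinset n, ‖f m‖ ^ 2 :=
        Finset.sum_le_sum h1
    _ = (3 ^ d : ℝ) * ∑ m ∈ s.biUnion fun n => (domainGraph Ω).neighborFinset n,
        ∑ n ∈ s.filter (fun n => (domainGraph Ω).Adj n m), ‖f m‖ ^ 2 := by
        rw [← Finset.mul_sum, h2]
    _ ≤ (3 ^ d : ℝ) * ∑ m ∈ s.biUnion fun n => (domainGraph Ω).neighborFinset n,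
        (3 ^ d : ℝ) * ‖f m‖ ^ 2 := by
        gcongr with m hm
        rw [Finset.sum_const, nsmul_eq_mul]
        gcongr
        refine le_trans ?_ (hcard m)
        exact_mod_cast Finset.card_le_card fun n hn => by
          rw [SimpleGraph.mem_neighborFinset]
          exact (Finset.mem_filter.mp hn).2.symm
    _ = (3 ^ d : ℝ) ^ 2 * ∑ m ∈ s.biUnion fun n => (domainGraph Ω).neighborFinset n, ‖f m‖ ^ 2 := by
        rw [← Finset.mul_sum]
        ring
    _ ≤ (3 ^ d : ℝ) ^ 2 * ‖f‖ ^ 2 := by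
        gcongr
        simpa using lp.sum_rpow_le_norm_rpow (p := 2) (by simp) f
          (s.biUnion fun n => (domainGraph Ω).neighborFinset n)
    _ = _ := by ring

/-- The adjacency operator of the domain, the free Schrödinger operator on `ℓ²(Ω)`. -/
noncomputable def adjOp : ellTwo Ω →L[ℂ] ellTwo Ω :=
  LinearMap.mkContinuous
    { toFun := fun f => ⟨schrodingerExpr Ω 0 f,
        memℓp_gen' (C := ((3 ^ d : ℝ) * ‖f‖) ^ 2) fun s => by
          simpa using sum_norm_sq_adj_le Ω f s⟩
      map_add' := fun f g => by
        apply Subtype.ext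
        show schrodingerExpr Ω 0 ((f + g : ellTwo Ω) : Ω → ℂ) = _
        rw [lp.coeFn_add, map_add]
        rfl
      map_smul' := fun c f => by
        apply Subtype.ext
        show schrodingerExpr Ω 0 ((c • f : ellTwo Ω) : Ω → ℂ) = _
        rw [lp.coeFn_smul, map_smul]
        rfl }
    (3 ^ d) fun f => lp.norm_le_of_forall_sum_le (by simp) (by positivity) fun s => by
      simpa using sum_norm_sq_adj_le Ω f s

theorem adjOp_apply (f : ellTwo Ω) (n : Ω) : adjOp Ω f n = schrodingerExpr Ω 0 f n := rfl

/-- Multiplication by a bounded function on `ℓ²(Ω)`. -/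
noncomputable def diagOp (b : Ω → ℂ) (C : ℝ) (hb : ∀ n, ‖b n‖ ≤ C) : ellTwo Ω →L[ℂ] ellTwo Ω :=
  LinearMap.mkContinuous
    { toFun := fun f => ⟨fun n => b n * f n,
        Memℓp.mono' (lp.memℓp ((C : ℂ) • f)) fun n => by
          rw [lp.coeFn_smul, Pi.smul_apply, norm_mul, norm_smul]
          gcongr
          rw [Complex.norm_real]
          exact (hb n).trans (Real.le_norm_self C)⟩
      map_add' := fun f g => by
        ext n
        exact mul_add _ _ _
      map_smul' := fun c f => by
        ext n
        exact mul_left_comm _ _ _ }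
    |C| fun f => by
      have hC : |C| * ‖f‖ = ‖(C : ℂ) • f‖ := by
        rw [norm_smul, Complex.norm_real, Real.norm_eq_abs]
      refine (lp.norm_mono (by simp) fun n => ?_).trans hC.ge
      rw [lp.coeFn_smul, Pi.smul_apply, norm_smul]
      show ‖b n * f n‖ ≤ _
      rw [norm_mul]
      gcongr
      rw [Complex.norm_real]
      exact (hb n).trans (Real.le_norm_self C)

theorem diagOp_apply (b : Ω → ℂ) (C : ℝ) (hb : ∀ n, ‖b n‖ ≤ C) (f : ellTwo Ω) (n : Ω) :
    diagOp Ω b C hb f n = b n * f n := rfl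

theorem norm_diagOp_le (b : Ω → ℂ) (C : ℝ) (hC : 0 ≤ C) (hb : ∀ n, ‖b n‖ ≤ C) :
    ‖diagOp Ω b C hb‖ ≤ C :=
  (LinearMap.mkContinuous_norm_le _ (abs_nonneg C) _).trans (abs_of_nonneg hC).le

/-- A bounded operator on `ℓ²(Ω)` whose matrix is conjugate to that of another one is its
adjoint. -/
theorem star_eq_of_matrix {A B : ellTwo Ω →L[ℂ] ellTwo Ω}
    (h : ∀ m n : Ω, star (A (lp.single 2 n 1) m) = B (lp.single 2 m 1) n) : star A = B := by
  refine lp.ext_continuousLinearMap (by simp) fun m => ?_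
  ext n
  simp only [ContinuousLinearMap.comp_apply]
  have h1 : (star A (lp.single 2 m 1) : ellTwo Ω) n = B (lp.single 2 m 1) n := by
    have := lp.inner_single_left (𝕜 := ℂ) n (1 : ℂ) (star A (lp.single 2 m 1))
    rw [ContinuousLinearMap.star_eq_adjoint, ContinuousLinearMap.adjoint_inner_right,
      lp.inner_single_right] at this
    rw [← h, ContinuousLinearMap.star_eq_adjoint]
    simpa using this.symm
  exact h1

theorem star_adjOp : star (adjOp Ω) = adjOp Ω := by
  classical
  refine star_eq_of_matrix Ω fun m n => ?_
  rw [adjOp_apply, adjOp_apply, schrodingerExpr_zero_apply, schrodingerExpr_zero_apply]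
  simp only [lp.single_apply, Pi.single_apply, Finset.sum_ite_eq', SimpleGraph.mem_neighborFinset,
    SimpleGraph.adj_comm]
  split_ifs <;> simp

theorem star_diagOp (b : Ω → ℂ) (C : ℝ) (hb : ∀ n, ‖b n‖ ≤ C) (hb' : ∀ n, ‖star (b n)‖ ≤ C) :
    star (diagOp Ω b C hb) = diagOp Ω (fun n => star (b n)) C hb' := by
  classical
  refine star_eq_of_matrix Ω fun m n => ?_
  rw [diagOp_apply, diagOp_apply]
  simp only [lp.single_apply, Pi.single_apply]
  by_cases hmn : m = n
  · subst hmn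
    simp
  · simp [hmn, Ne.symm hmn]

/-- The bound `‖A‖ + 1`, which makes `iK` a distance more than `‖A‖` from the real axis. -/
noncomputable def baseHeight : ℝ := ‖adjOp Ω‖ + 1

theorem baseHeight_pos : 0 < baseHeight Ω := by
  unfold baseHeight
  positivity

variable (v : Ω → ℝ)

theorem sub_base_ne_zero (n : Ω) : (v n : ℂ) - Complex.I * baseHeight Ω ≠ 0 := fun h => by
  have := congrArg Complex.im h
  simp at this
  exact (baseHeight_pos Ω).ne' this

theorem norm_inv_sub_base_le (n : Ω) :
    ‖((v n : ℂ) - Complex.I * baseHeight Ω)⁻¹‖ ≤ (baseHeight Ω)⁻¹ := by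
  rw [norm_inv]
  refine inv_anti₀ (baseHeight_pos Ω) ?_
  have := Complex.abs_im_le_norm ((v n : ℂ) - Complex.I * baseHeight Ω)
  simp at this
  exact (le_abs_self _).trans this

/-- Resolvent at `iK` of the multiplication by `v`. -/
noncomputable def potentialRes : ellTwo Ω →L[ℂ] ellTwo Ω :=
  diagOp Ω (fun n => ((v n : ℂ) - Complex.I * baseHeight Ω)⁻¹) (baseHeight Ω)⁻¹
    (norm_inv_sub_base_le Ω v)

/-- Pointwise, this is the resolvent identity for the numbers `(v n - iK)⁻¹`; diagonal operators
commute. -/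
theorem potentialRes_sub_star :
    potentialRes Ω v - star (potentialRes Ω v) =
      (2 * Complex.I * baseHeight Ω) • (star (potentialRes Ω v) * potentialRes Ω v) ∧
    Commute (star (potentialRes Ω v)) (potentialRes Ω v) := by
  have hb' : ∀ n, ‖star ((v n : ℂ) - Complex.I * baseHeight Ω)⁻¹‖ ≤ (baseHeight Ω)⁻¹ := fun n => by
    rw [norm_star]
    exact norm_inv_sub_base_le Ω v n
  unfold potentialRes
  rw [star_diagOp Ω _ _ _ hb']
  constructor
  · ext f n
    simp only [sub_apply, smul_apply, mul_apply_eq_comp, lp.coeFn_sub, lp.coeFn_smul, Pi.sub_apply,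
      Pi.smul_apply, diagOp_apply, smul_eq_mul]
    have h1 := sub_base_ne_zero Ω v n
    have h2 : (v n : ℂ) + Complex.I * baseHeight Ω ≠ 0 := by
      simpa using (map_ne_zero (starRingEnd ℂ)).mpr h1
    have h3 : star ((v n : ℂ) - Complex.I * baseHeight Ω)⁻¹ =
        ((v n : ℂ) + Complex.I * baseHeight Ω)⁻¹ := by
      simp
    rw [h3]
    field_simp
    ring
  · ext f n
    simp only [mul_apply_eq_comp, diagOp_apply]
    ring

/-- The resolvent at `iK` of the Schrödinger operator. -/
noncomputable def schrodingerRes : ellTwo Ω →L[ℂ] ellTwo Ω :=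
  potentialRes Ω v * Ring.inverse (1 + adjOp Ω * potentialRes Ω v)

theorem norm_potentialRes_le : ‖potentialRes Ω v‖ ≤ (baseHeight Ω)⁻¹ :=
  norm_diagOp_le _ _ _ (inv_nonneg.mpr (baseHeight_pos Ω).le) _

theorem norm_adjOp_mul_lt : ‖adjOp Ω‖ * (baseHeight Ω)⁻¹ < 1 := by
  rw [← div_eq_mul_inv, div_lt_one (baseHeight_pos Ω)]
  unfold baseHeight
  linarith

theorem isUnit_one_add : IsUnit (1 + adjOp Ω * potentialRes Ω v) := by
  have : IsUnit (1 - -(adjOp Ω * potentialRes Ω v)) := by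
    apply isUnit_one_sub_of_norm_lt_one
    rw [norm_neg]
    refine (norm_mul_le _ _).trans_lt (lt_of_le_of_lt ?_ (norm_adjOp_mul_lt Ω))
    gcongr
    exact norm_potentialRes_le Ω v
  simpa using this

theorem isUnit_one_add' : IsUnit (1 + potentialRes Ω v * adjOp Ω) := by
  have : IsUnit (1 - -(potentialRes Ω v * adjOp Ω)) := by
    apply isUnit_one_sub_of_norm_lt_one
    rw [norm_neg]
    refine (norm_mul_le _ _).trans_lt (lt_of_le_of_lt ?_ (norm_adjOp_mul_lt Ω))
    rw [mul_comm]
    gcongr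
    exact norm_potentialRes_le Ω v
  simpa using this

theorem schrodingerRes_mul :
    schrodingerRes Ω v * (1 + adjOp Ω * potentialRes Ω v) = potentialRes Ω v := by
  unfold schrodingerRes
  rw [mul_assoc, Ring.inverse_mul_cancel _ (isUnit_one_add Ω v), mul_one]

theorem mul_schrodingerRes :
    (1 + potentialRes Ω v * adjOp Ω) * schrodingerRes Ω v = potentialRes Ω v := by
  unfold schrodingerRes
  have h : (1 + potentialRes Ω v * adjOp Ω) * potentialRes Ω v =
      potentialRes Ω v * (1 + adjOp Ω * potentialRes Ω v) := by noncomm_ring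
  rw [← mul_assoc, h, mul_assoc, Ring.mul_inverse_cancel _ (isUnit_one_add Ω v), mul_one]

/-- With `R(1 + AD) = D = (1 + DA)R` and `A` self-adjoint, multiplying each identity by suitable
invertible factors on both sides cancels the terms in `A` and reduces it to the identity for the
diagonal operator `D`. -/
theorem isResolventAtI_schrodingerRes : IsResolventAtI (schrodingerRes Ω v) (baseHeight Ω) := by
  set D := potentialRes Ω v with hD
  set A := adjOp Ω with hA
  set R := schrodingerRes Ω v with hR
  have hAs : star A = A := star_adjOp Ω
  obtain ⟨hDs, hDc⟩ := potentialRes_sub_star Ω v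
  have e1 : R * (1 + A * D) = D := schrodingerRes_mul Ω v
  have e2 : (1 + D * A) * R = D := mul_schrodingerRes Ω v
  have e1' : (1 + star D * A) * star R = star D := by
    have := congrArg star e1
    rwa [star_mul, star_add, star_mul, hAs, star_one] at this
  have e2' : star R * (1 + A * star D) = star D := by
    have := congrArg star e2
    rwa [star_mul, star_add, star_mul, hAs, star_one] at this
  have u1 := isUnit_one_add Ω v
  have u2 := isUnit_one_add' Ω v
  have u1' : IsUnit (1 + star D * A) := by
    have := u1.star
    rwa [star_add, star_mul, hAs, star_one] at this
  have u2' : IsUnit (1 + A * star D) := by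
    have := u2.star
    rwa [star_add, star_mul, hAs, star_one] at this
  refine ⟨?_, ?_, baseHeight_pos Ω⟩
  · apply u1'.mul_left_cancel
    apply u1.mul_right_cancel
    rw [← hD, ← hA]
    calc (1 + star D * A) * (R - star R) * (1 + A * D)
        = (1 + star D * A) * (R * (1 + A * D)) - ((1 + star D * A) * star R) * (1 + A * D) := by
          noncomm_ring
      _ = D - star D := by
          rw [e1, e1']
          noncomm_ring
      _ = (2 * Complex.I * baseHeight Ω) • (((1 + star D * A) * star R) * (R * (1 + A * D))) := by
          rw [e1, e1', hDs]
      _ = _ := by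
          simp only [mul_smul_comm, smul_mul_assoc, mul_assoc]
  · apply u2.mul_left_cancel
    apply u2'.mul_right_cancel
    rw [← hD, ← hA]
    calc (1 + D * A) * (R - star R) * (1 + A * star D)
        = ((1 + D * A) * R) * (1 + A * star D) - (1 + D * A) * (star R * (1 + A * star D)) := by
          noncomm_ring
      _ = D - star D := by
          rw [e2, e2']
          noncomm_ring
      _ = (2 * Complex.I * baseHeight Ω) • (((1 + D * A) * R) * (star R * (1 + A * star D))) := by
          rw [e2, e2', hDs, hDc.eq]
      _ = _ := by
          simp only [mul_smul_comm, smul_mul_assoc, mul_assoc]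

/-- For `f = Dη` with `(1 + AD)η = χ`, the potential part gives `(v - iK)f = η` and the hopping part
gives `Af = χ - η`; add the two. -/
theorem schrodingerExpr_schrodingerRes (χ : ellTwo Ω) (n : Ω) :
    schrodingerExpr Ω v (schrodingerRes Ω v χ) n =
      χ n + Complex.I * baseHeight Ω * schrodingerRes Ω v χ n := by
  set η := Ring.inverse (1 + adjOp Ω * potentialRes Ω v) χ with hη
  have h1 : schrodingerRes Ω v χ = potentialRes Ω v η := rfl
  have h2 : η + adjOp Ω (potentialRes Ω v η) = χ := by
    have := congrArg (fun A : ellTwo Ω →L[ℂ] ellTwo Ω => A χ)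
      (Ring.mul_inverse_cancel _ (isUnit_one_add Ω v))
    simpa only [mul_apply_eq_comp, add_apply, one_apply_eq_self] using this
  have h3 := congrArg (fun f : ellTwo Ω => f n) h2
  simp only [lp.coeFn_add, Pi.add_apply, adjOp_apply] at h3
  have h4 : ((v n : ℂ) - Complex.I * baseHeight Ω) * potentialRes Ω v η n = η n := by
    show _ * (_ * η n) = η n
    rw [← mul_assoc, mul_inv_cancel₀ (sub_base_ne_zero Ω v n), one_mul]
  rw [h1, schrodingerExpr_eq_add]
  linear_combination h3 + h4

/-- The resolvent of the Schrödinger operator at a nonreal point. -/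
noncomputable def schrodingerResAt (z : ℂ) : ellTwo Ω →L[ℂ] ellTwo Ω :=
  resolventAt (schrodingerRes Ω v) (baseHeight Ω) z

theorem schrodingerExpr_schrodingerResAt {z : ℂ} (hz : z.im ≠ 0) (φ : ellTwo Ω) (n : Ω) :
    schrodingerExpr Ω v (schrodingerResAt Ω v z φ) n = φ n + z * schrodingerResAt Ω v z φ n := by
  obtain ⟨χ, h1, h2⟩ := (isResolventAtI_schrodingerRes Ω v).resolventAt_apply hz φ
  have h3 := congrArg (fun f : ellTwo Ω => f n) h2
  simp only [lp.coeFn_add, Pi.add_apply, lp.coeFn_smul, Pi.smul_apply, smul_eq_mul] at h3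
  unfold schrodingerResAt
  rw [h1, schrodingerExpr_schrodingerRes]
  rw [h1] at h3
  linear_combination h3

/-- Every vector has a spectral measure for the Schrödinger operator. -/
theorem exists_isSpectralMeasure (φ : ellTwo Ω) :
    ∃ μ : Measure ℝ, IsSpectralMeasure (schrodingerOp Ω v) φ μ ∧ ∀ z : ℂ, z.im ≠ 0 →
      ‖schrodingerResAt Ω v z φ‖ ^ 2 = ∫ t : ℝ, ‖((t : ℂ) - z)⁻¹‖ ^ 2 ∂μ := by
  obtain ⟨μ, hμ, h⟩ := (isResolventAtI_schrodingerRes Ω v).exists_measure φ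
  refine ⟨μ, ⟨hμ, fun z hz => ?_⟩, fun z hz => (h z hz).2⟩
  have he : schrodingerExpr Ω v (schrodingerResAt Ω v z φ) =
      ((φ + z • schrodingerResAt Ω v z φ : ellTwo Ω) : Ω → ℂ) := by
    funext n
    exact schrodingerExpr_schrodingerResAt Ω v hz φ n
  have hmem : Memℓp (schrodingerExpr Ω v (schrodingerResAt Ω v z φ)) 2 := by
    rw [he]
    exact lp.memℓp _
  refine ⟨⟨schrodingerResAt Ω v z φ, hmem⟩, ?_, (h z hz).1⟩
  rw [sub_eq_iff_eq_add]
  exact Subtype.ext he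

end Operators
-- Slowly growing solutions force resolvent blow-up.
section CutoffEstimate

variable {d : ℕ} {Ω : Set (Fin d → ℤ)} {v : Ω → ℝ}

/-- The hopping part is bounded and self-adjoint. Subtracting it leaves the products `v f` and `v
g`, which are again in ℓ², so the real potential moves across the inner product term by term even
when unbounded. -/
theorem inner_schrodingerExpr_symm {f g F G : ellTwo Ω}
    (hF : ∀ n, F n = schrodingerExpr Ω v f n) (hG : ∀ n, G n = schrodingerExpr Ω v g n) :
    inner ℂ F g = inner ℂ f G := by
  have h1 : inner ℂ (adjOp Ω f) g = inner ℂ f (adjOp Ω g) := by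
    conv_lhs => rw [← star_adjOp, ContinuousLinearMap.star_eq_adjoint,
      ContinuousLinearMap.adjoint_inner_left]
  have h2 : inner ℂ (F - adjOp Ω f) g = inner ℂ f (G - adjOp Ω g) := by
    rw [lp.inner_eq_tsum, lp.inner_eq_tsum]
    congr 1
    funext n
    have e1 : (F - adjOp Ω f) n = (v n : ℂ) * f n := by
      rw [lp.coeFn_sub, Pi.sub_apply, hF, adjOp_apply, schrodingerExpr_eq_add]
      ring
    have e2 : (G - adjOp Ω g) n = (v n : ℂ) * g n := by
      rw [lp.coeFn_sub, Pi.sub_apply, hG, adjOp_apply, schrodingerExpr_eq_add]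
      ring
    rw [e1, e2]
    simp only [RCLike.inner_apply, map_mul, Complex.conj_ofReal]
    ring
  rw [inner_sub_left, inner_sub_right, h1] at h2
  exact sub_left_injective h2

/-- With `(h - z)ψ = φ`, symmetry gives `⟨φ, w⟩ = ⟨ψ, (h - z̄)w⟩`, and `(h - z̄)w = G + i (Im z) w`.
-/
theorem norm_inner_le_resolvent {z : ℂ} (hz : z.im ≠ 0) (φ : ellTwo Ω) {w G : ellTwo Ω}
    (hG : ∀ n, G n = schrodingerExpr Ω v w n - (z.re : ℂ) * w n) :
    ‖inner ℂ φ w‖ ≤ ‖schrodingerResAt Ω v z φ‖ * (‖G‖ + |z.im| * ‖w‖) := by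
  set ψ := schrodingerResAt Ω v z φ with hψ
  have h1 : inner ℂ (φ + z • ψ) w = inner ℂ ψ (G + (z.re : ℂ) • w) := by
    refine inner_schrodingerExpr_symm (v := v) (fun n => ?_) (fun n => ?_)
    · rw [hψ, schrodingerExpr_schrodingerResAt Ω v hz]
      rfl
    · rw [lp.coeFn_add, Pi.add_apply, hG, lp.coeFn_smul, Pi.smul_apply, smul_eq_mul]
      ring
  have h2 : inner ℂ φ w = inner ℂ ψ (G + (Complex.I * z.im) • w) := by
    rw [inner_add_left, inner_add_right, inner_smul_left, inner_smul_right] at h1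
    rw [inner_add_right, inner_smul_right]
    have h3 : (starRingEnd ℂ) z = z.re - Complex.I * z.im := by
      apply Complex.ext <;> simp
    rw [h3] at h1
    linear_combination h1
  rw [h2]
  refine (norm_inner_le_norm _ _).trans ?_
  gcongr
  refine (norm_add_le _ _).trans ?_
  rw [norm_smul, norm_mul, Complex.norm_I, one_mul, Complex.norm_real, Real.norm_eq_abs]

/-- The cube `C_R ∩ Ω`. -/
def cube (Ω : Set (Fin d → ℤ)) (R : ℝ) : Set Ω := {n | ∀ i, |((n : Fin d → ℤ) i : ℝ)| ≤ R}

theorem mem_cube_iff {R : ℝ} (hR : 0 ≤ R) (n : Ω) : n ∈ cube Ω R ↔ ‖n.1‖ ≤ R := by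
  rw [pi_norm_le_iff_of_nonneg hR]
  simp only [cube, Set.mem_ofPred_eq, Int.norm_eq_abs]

theorem cubeMass_eq_tsum_indicator (u : Ω → ℂ) (R : ℝ) :
    cubeMass Ω u R = ∑' n : Ω, (cube Ω R).indicator (fun n => ‖u n‖ₑ ^ 2) n :=
  tsum_subtype (cube Ω R) fun n => ‖u n‖ₑ ^ 2

theorem cubeMass_mono (u : Ω → ℂ) {R R' : ℝ} (h : R ≤ R') : cubeMass Ω u R ≤ cubeMass Ω u R' := by
  rw [cubeMass_eq_tsum_indicator, cubeMass_eq_tsum_indicator]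
  refine ENNReal.tsum_le_tsum fun n => ?_
  exact Set.indicator_le_indicator_of_subset (fun n hn i => (hn i).trans h) (fun _ => zero_le) n

/-- Truncation to a cube of finite mass. -/
noncomputable def truncation (u : Ω → ℂ) (R : ℝ) (h : cubeMass Ω u R ≠ ∞) : ellTwo Ω :=
  ⟨(cube Ω R).indicator u, by
    refine memℓp_gen ?_
    have h1 : Summable fun n => ((cube Ω R).indicator (fun n => ‖u n‖ₑ ^ 2) n).toReal :=
      ENNReal.summable_toReal (by rwa [← cubeMass_eq_tsum_indicator])
    refine h1.congr fun n => ?_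
    by_cases hn : n ∈ cube Ω R <;> simp [hn]⟩

theorem norm_truncation_sq (u : Ω → ℂ) (R : ℝ) (h : cubeMass Ω u R ≠ ∞) :
    ‖truncation u R h‖ ^ 2 = (cubeMass Ω u R).toReal := by
  have h0 := lp.norm_rpow_eq_tsum (p := 2) (by simp) (truncation u R h)
  simp only [ENNReal.toReal_ofNat, Real.rpow_ofNat] at h0
  rw [h0, cubeMass_eq_tsum_indicator, ENNReal.tsum_toReal_eq]
  · congr 1
    funext n
    show ‖(cube Ω R).indicator u n‖ ^ 2 = _
    by_cases hn : n ∈ cube Ω R <;> simp [hn]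
  · intro n
    by_cases hn : n ∈ cube Ω R <;> simp [hn]

/-- The Lipschitz cutoff `max(0, 1 - |n|/k)`. -/
noncomputable def cutoff (k : ℕ) (n : Fin d → ℤ) : ℝ := max 0 (1 - ‖n‖ / k)

theorem cutoff_nonneg (k : ℕ) (n : Fin d → ℤ) : 0 ≤ cutoff k n := le_max_left _ _

theorem cutoff_le_one (k : ℕ) (n : Fin d → ℤ) : cutoff k n ≤ 1 :=
  max_le zero_le_one (by simp; positivity)

theorem cutoff_eq_zero {k : ℕ} (hk : 0 < k) {n : Fin d → ℤ} (h : (k : ℝ) ≤ ‖n‖) :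
    cutoff k n = 0 := by
  have : (0 : ℝ) < k := by exact_mod_cast hk
  apply max_eq_left
  rw [sub_nonpos, one_le_div this]
  exact h

theorem norm_sub_le_one_of_adj {n m : Ω} (h : (domainGraph Ω).Adj n m) : ‖n.1 - m.1‖ ≤ 1 := by
  rw [pi_norm_le_iff_of_nonneg zero_le_one]
  intro i
  rw [Int.norm_eq_abs]
  exact_mod_cast abs_sub_le_one_of_adj Ω h i

theorem abs_cutoff_sub_le {k : ℕ} (hk : 0 < k) {n m : Ω} (h : (domainGraph Ω).Adj n m) :
    |cutoff k m.1 - cutoff k n.1| ≤ (k : ℝ)⁻¹ := by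
  have hk' : (0 : ℝ) < k := by exact_mod_cast hk
  refine (abs_max_sub_max_le_max _ _ _ _).trans ?_
  rw [sub_self, abs_zero, max_eq_right (abs_nonneg _)]
  have : 1 - ‖m.1‖ / (k : ℝ) - (1 - ‖n.1‖ / k) = (‖n.1‖ - ‖m.1‖) / k := by ring
  rw [this, abs_div, abs_of_pos hk', div_eq_mul_inv]
  refine mul_le_of_le_one_left (inv_nonneg.mpr hk'.le) ?_
  exact (abs_norm_sub_norm_le _ _).trans (norm_sub_le_one_of_adj h)

theorem norm_cutoff_sub_mul_le {k : ℕ} (hk : 0 < k) (u : Ω → ℂ) (h : cubeMass Ω u k ≠ ∞) {n m : Ω}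
    (hnm : (domainGraph Ω).Adj n m) :
    ‖((cutoff k m.1 - cutoff k n.1 : ℝ) : ℂ) * u m‖ ≤ (k : ℝ)⁻¹ * ‖truncation u k h m‖ := by
  have hk' : (0 : ℝ) < k := by exact_mod_cast hk
  show _ ≤ _ * ‖(cube Ω k).indicator u m‖
  by_cases hm : m ∈ cube Ω k
  · rw [Set.indicator_of_mem hm, norm_mul, Complex.norm_real, Real.norm_eq_abs]
    gcongr
    exact abs_cutoff_sub_le hk hnm
  · have hm' : ¬ ∀ i, |m.1 i| ≤ (k : ℤ) := fun hcon => hm fun i => by exact_mod_cast hcon i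
    -- Integrality of the lattice and of `k` gives the extra `1`. Hence a neighbour of a site
    -- outside the cube still has norm at least `k`, where the cutoff vanishes, and no mass outside
    -- the cube enters.
    have h1 : (k : ℝ) + 1 ≤ ‖m.1‖ := by
      push Not at hm'
      obtain ⟨i, hi⟩ := hm'
      refine le_trans ?_ (norm_le_pi_norm m.1 i)
      rw [Int.norm_eq_abs]
      exact_mod_cast hi
    have h2 : (k : ℝ) ≤ ‖n.1‖ := by
      have := norm_sub_le_one_of_adj hnm.symm
      have := norm_sub_norm_le m.1 n.1
      linarith
    rw [cutoff_eq_zero hk h2, cutoff_eq_zero hk (by linarith : (k : ℝ) ≤ ‖m.1‖), sub_self,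
      Complex.ofReal_zero, zero_mul, norm_zero]
    positivity

/-- The error is a commutator: since `u` solves the equation, `(h - E)` applied to the cutoff of `u`
is the sum over neighbours of differences of the cutoff times `u m`. It is dominated pointwise by
`k⁻¹` times the adjacency operator applied to the absolute value of the truncation. -/
theorem exists_cutoff_vector {E : ℝ} {u : Ω → ℂ} (hu : schrodingerExpr Ω v u = (E : ℂ) • u)
    {k : ℕ} (hk : 0 < k) (h : cubeMass Ω u k ≠ ∞) :
    ∃ w G : ellTwo Ω, (∀ n, w n = (cutoff k n.1 : ℂ) * u n) ∧
      (∀ n, G n = schrodingerExpr Ω v w n - (E : ℂ) * w n) ∧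
      ‖w‖ ≤ ‖truncation u k h‖ ∧ ‖G‖ ≤ (k : ℝ)⁻¹ * ‖adjOp Ω‖ * ‖truncation u k h‖ := by
  have hk' : (0 : ℝ) < k := by exact_mod_cast hk
  set U := truncation u k h with hU
  have hw : ∀ n, ‖(cutoff k n.1 : ℂ) * u n‖ ≤ ‖U n‖ := fun n => by
    show _ ≤ ‖(cube Ω k).indicator u n‖
    by_cases hn : n ∈ cube Ω k
    · rw [Set.indicator_of_mem hn, norm_mul, Complex.norm_real, Real.norm_eq_abs,
        abs_of_nonneg (cutoff_nonneg _ _)]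
      exact mul_le_of_le_one_left (norm_nonneg _) (cutoff_le_one _ _)
    · rw [mem_cube_iff hk'.le, not_le] at hn
      rw [cutoff_eq_zero hk hn.le]
      simp
  let w : ellTwo Ω := ⟨fun n => (cutoff k n.1 : ℂ) * u n, Memℓp.mono' (lp.memℓp U) hw⟩
  let A : ellTwo Ω := ⟨fun n => (‖U n‖ : ℂ), Memℓp.mono' (lp.memℓp U) fun n => by simp⟩
  have hA : ‖A‖ ≤ ‖U‖ := lp.norm_mono (by simp) fun n => by
    show ‖(‖U n‖ : ℂ)‖ ≤ _
    simp
  have hG : ∀ n, ‖schrodingerExpr Ω v w n - (E : ℂ) * w n‖ ≤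
      ‖(((k : ℝ)⁻¹ : ℂ) • adjOp Ω A : ellTwo Ω) n‖ := fun n => by
    have hun := congrFun hu n
    rw [schrodingerExpr_apply, Pi.smul_apply, smul_eq_mul] at hun
    have e1 : schrodingerExpr Ω v w n - (E : ℂ) * w n =
        ∑ m ∈ (domainGraph Ω).neighborFinset n,
          ((cutoff k m.1 - cutoff k n.1 : ℝ) : ℂ) * u m := by
      rw [schrodingerExpr_apply]
      show (∑ m ∈ (domainGraph Ω).neighborFinset n, (cutoff k m.1 : ℂ) * u m) +
        (v n : ℂ) * ((cutoff k n.1 : ℂ) * u n) - (E : ℂ) * ((cutoff k n.1 : ℂ) * u n) = _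
      simp only [Complex.ofReal_sub, sub_mul, Finset.sum_sub_distrib, ← Finset.mul_sum]
      linear_combination (cutoff k n.1 : ℂ) * hun
    have e2 : ‖(((k : ℝ)⁻¹ : ℂ) • adjOp Ω A : ellTwo Ω) n‖ =
        ∑ m ∈ (domainGraph Ω).neighborFinset n, (k : ℝ)⁻¹ * ‖U m‖ := by
      rw [lp.coeFn_smul, Pi.smul_apply, adjOp_apply, schrodingerExpr_zero_apply]
      have : ∑ m ∈ (domainGraph Ω).neighborFinset n, A m =
          ((∑ m ∈ (domainGraph Ω).neighborFinset n, ‖U m‖ : ℝ) : ℂ) := by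
        rw [Complex.ofReal_sum]
      rw [this, norm_smul, Complex.norm_real, Real.norm_of_nonneg (by positivity), Finset.mul_sum]
      simp
    rw [e1, e2]
    refine (norm_sum_le _ _).trans (Finset.sum_le_sum fun m hm => ?_)
    exact norm_cutoff_sub_mul_le hk u h (by simpa using hm)
  let G : ellTwo Ω := ⟨fun n => schrodingerExpr Ω v w n - (E : ℂ) * w n,
    Memℓp.mono' (lp.memℓp (((k : ℝ)⁻¹ : ℂ) • adjOp Ω A : ellTwo Ω)) hG⟩
  refine ⟨w, G, fun n => rfl, fun n => rfl, lp.norm_mono (by simp) hw, ?_⟩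
  calc ‖G‖ ≤ ‖(((k : ℝ)⁻¹ : ℂ) • adjOp Ω A : ellTwo Ω)‖ := lp.norm_mono (by simp) hG
    _ = (k : ℝ)⁻¹ * ‖adjOp Ω A‖ := by
        rw [norm_smul]
        simp
    _ ≤ (k : ℝ)⁻¹ * (‖adjOp Ω‖ * ‖U‖) := by
        gcongr
        exact ((adjOp Ω).le_opNorm A).trans (by gcongr)
    _ = _ := by ring

/-- Rounding `R` down to `k = ⌊R⌋` only decreases the mass, and `R ≤ 2k` once `R ≥ 1`, which costs a
factor `2 ^ α`. -/
theorem HasSlowGrowth.exists_frequently {α : ℝ} (hα : 0 ≤ α) {u : Ω → ℂ}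
    (h : HasSlowGrowth Ω α u) :
    ∃ C : ℝ, 0 < C ∧ ∃ᶠ k : ℕ in atTop, cubeMass Ω u k ≤ ENNReal.ofReal (C * (k : ℝ) ^ α) := by
  obtain ⟨C, hC1, -⟩ := ENNReal.lt_iff_exists_nnreal_btwn.mp h
  have hfreq := frequently_lt_of_liminf_lt (by isBoundedDefault) hC1
  refine ⟨(C + 1) * 2 ^ α, by positivity, ?_⟩
  rw [frequently_atTop] at hfreq ⊢
  intro N
  obtain ⟨R, hR, hlt⟩ := hfreq (N + 1)
  have hR0 : 0 < R := by
    have : (0 : ℝ) ≤ N := N.cast_nonneg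
    linarith
  have hR1 : 1 ≤ R := by
    have : (0 : ℝ) ≤ N := N.cast_nonneg
    linarith
  refine ⟨⌊R⌋₊, Nat.le_floor (by linarith), ?_⟩
  have hk1 : (1 : ℝ) ≤ ⌊R⌋₊ := by
    exact_mod_cast Nat.le_floor (by simpa using hR1)
  have hk2 : R ≤ 2 * ⌊R⌋₊ := by
    have := (Nat.lt_floor_add_one R).le
    linarith
  have h1 : cubeMass Ω u R ≤ ENNReal.ofReal (R ^ α) * C := by
    have hpos : 0 < R ^ α := Real.rpow_pos_of_pos hR0 α
    calc cubeMass Ω u R = ENNReal.ofReal (R ^ α) *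
          (ENNReal.ofReal (R ^ (-α)) * cubeMass Ω u R) := by
          rw [← mul_assoc, ← ENNReal.ofReal_mul hpos.le, ← Real.rpow_add hR0]
          simp
      _ ≤ _ := by gcongr
  calc cubeMass Ω u ⌊R⌋₊ ≤ cubeMass Ω u R := cubeMass_mono u (Nat.floor_le hR0.le)
    _ ≤ ENNReal.ofReal (R ^ α) * C := h1
    _ = ENNReal.ofReal (R ^ α * C) := by
        rw [ENNReal.ofReal_mul (by positivity), ENNReal.ofReal_coe_nnreal]
    _ ≤ _ := by
        apply ENNReal.ofReal_le_ofReal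
        calc R ^ α * C ≤ (2 * ⌊R⌋₊) ^ α * (C + 1) := by
              gcongr
              linarith
          _ = _ := by
              rw [Real.mul_rpow (by norm_num) (by positivity)]
              ring

/-- The point `E + i/k`, approaching `E` from the upper half plane. -/
noncomputable def approachPt (E : ℝ) (k : ℕ) : ℂ := E + Complex.I * ((k : ℝ)⁻¹ : ℝ)

@[simp] theorem approachPt_re (E : ℝ) (k : ℕ) : (approachPt E k).re = E := by simp [approachPt]

@[simp] theorem approachPt_im (E : ℝ) (k : ℕ) : (approachPt E k).im = (k : ℝ)⁻¹ := by
  simp [approachPt]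

/-- A slowly growing solution that does not vanish at `n` forces the resolvent applied to `δ_n` to
blow up near `E`. -/
theorem resolvent_lower_bound {α : ℝ} (hα : 0 ≤ α) {E : ℝ} {u : Ω → ℂ}
    (hu : schrodingerExpr Ω v u = (E : ℂ) • u) (hs : HasSlowGrowth Ω α u) {n : Ω} (hn : u n ≠ 0) :
    ∃ c : ℝ, 0 < c ∧ ∃ᶠ k : ℕ in atTop,
      c ≤ (k : ℝ) ^ (α - 2) * ‖schrodingerResAt Ω v (approachPt E k) (lp.single 2 n 1)‖ ^ 2 := by
  obtain ⟨C, hC, hfreq⟩ := hs.exists_frequently hα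
  have hun : 0 < ‖u n‖ := norm_pos_iff.mpr hn
  set B := ‖adjOp Ω‖ + 1 with hB
  have hB0 : 0 < B := by positivity
  -- Obtained by squaring `‖u n‖ / 2 ≤ ‖ψ‖ * (k⁻¹ * B * ‖U‖)` and inserting `‖U‖ ^ 2 ≤ C * k ^ α`.
  -- The factor `1/2` bounds the cutoff at `n` from below as soon as `k ≥ 2‖n‖`.
  refine ⟨‖u n‖ ^ 2 / (4 * B ^ 2 * C), by positivity, ?_⟩
  have hev : ∀ᶠ k : ℕ in atTop, 0 < k ∧ 2 * ‖n.1‖ ≤ k := by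
    refine (eventually_gt_atTop 0).and ?_
    exact tendsto_natCast_atTop_atTop.eventually_ge_atTop _
  refine (hfreq.and_eventually hev).mono ?_
  rintro k ⟨hmass, hk, hnk⟩
  have hk' : (0 : ℝ) < k := by exact_mod_cast hk
  have hfin : cubeMass Ω u k ≠ ∞ := (hmass.trans_lt ENNReal.ofReal_lt_top).ne
  obtain ⟨w, G, hw, hG, hwn, hGn⟩ := exists_cutoff_vector hu hk hfin
  set U := truncation u k hfin with hU
  have hUn : ‖U‖ ^ 2 ≤ C * (k : ℝ) ^ α := by
    rw [hU, norm_truncation_sq]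
    exact ENNReal.toReal_le_of_le_ofReal (by positivity) hmass
  have hz : (approachPt E k).im ≠ 0 := by
    rw [approachPt_im]
    exact (inv_pos.mpr hk').ne'
  have h1 := norm_inner_le_resolvent (v := v) hz (lp.single 2 n (1 : ℂ)) (w := w) (G := G)
    (by simpa using hG)
  rw [lp.inner_single_left, approachPt_im, abs_of_pos (inv_pos.mpr hk')] at h1
  set ψ := schrodingerResAt Ω v (approachPt E k) (lp.single 2 n 1) with hψ
  have h2 : ‖u n‖ / 2 ≤ ‖(inner ℂ (1 : ℂ) (w n) : ℂ)‖ := by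
    have hc : 1 / 2 ≤ cutoff k n.1 := by
      refine le_trans ?_ (le_max_right _ _)
      have : ‖n.1‖ / k ≤ 1 / 2 := by
        rw [div_le_iff₀ hk']
        linarith
      linarith
    rw [hw]
    simp only [RCLike.inner_apply, map_one, mul_one, norm_mul, Complex.norm_real, Real.norm_eq_abs]
    rw [abs_of_nonneg (cutoff_nonneg _ _)]
    nlinarith
  have h3 : ‖u n‖ / 2 ≤ ‖ψ‖ * ((k : ℝ)⁻¹ * B * ‖U‖) := by
    refine h2.trans (h1.trans ?_)
    gcongr
    calc ‖G‖ + (k : ℝ)⁻¹ * ‖w‖ ≤ (k : ℝ)⁻¹ * ‖adjOp Ω‖ * ‖U‖ + (k : ℝ)⁻¹ * ‖U‖ := by gcongr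
      _ = _ := by
        rw [hB]
        ring
  have h4 : (‖u n‖ / 2) ^ 2 ≤ ‖ψ‖ ^ 2 * (((k : ℝ)⁻¹) ^ 2 * B ^ 2 * (C * (k : ℝ) ^ α)) := by
    calc (‖u n‖ / 2) ^ 2 ≤ (‖ψ‖ * ((k : ℝ)⁻¹ * B * ‖U‖)) ^ 2 := by gcongr
      _ = ‖ψ‖ ^ 2 * (((k : ℝ)⁻¹) ^ 2 * B ^ 2 * ‖U‖ ^ 2) := by ring
      _ ≤ _ := by gcongr
  have h5 : (k : ℝ) ^ (α - 2) = ((k : ℝ)⁻¹) ^ 2 * (k : ℝ) ^ α := by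
    rw [Real.rpow_sub hk', Real.rpow_ofNat]
    field_simp
  rw [div_le_iff₀ (by positivity), h5]
  linarith

end CutoffEstimate
-- From large Poisson integrals to upper densities and Hausdorff null sets.
section HausdorffDensity

theorem norm_inv_sub_sq (t E ε : ℝ) :
    ‖((t : ℂ) - (E + Complex.I * ε))⁻¹‖ ^ 2 = ((t - E) ^ 2 + ε ^ 2)⁻¹ := by
  rw [norm_inv, inv_pow, Complex.sq_norm, Complex.normSq_apply]
  simp
  ring

/-- One term suffices: take the least `j` whose ball contains `t`. If `j ≥ 1` then `|t - E| > 2 ^ (j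
- 1) * ε`, which produces the factor `4`; for `j = 0` that factor is slack. -/
theorem poisson_le_tsum_indicator {E ε : ℝ} (hε : 0 < ε) (t : ℝ) :
    ENNReal.ofReal (((t - E) ^ 2 + ε ^ 2)⁻¹) ≤
      ∑' j : ℕ, (Metric.closedBall E (2 ^ j * ε)).indicator
        (fun _ => ENNReal.ofReal (4 * (4 ^ j)⁻¹ * (ε ^ 2)⁻¹)) t := by
  classical
  have hex : ∃ j : ℕ, |t - E| ≤ 2 ^ j * ε := by
    obtain ⟨j, hj⟩ := pow_unbounded_of_one_lt (|t - E| / ε) (one_lt_two : (1 : ℝ) < 2)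
    exact ⟨j, ((div_lt_iff₀ hε).mp hj).le⟩
  obtain ⟨j, hj, hmin⟩ : ∃ j : ℕ, |t - E| ≤ 2 ^ j * ε ∧ ∀ i < j, ¬ |t - E| ≤ 2 ^ i * ε :=
    ⟨Nat.find hex, Nat.find_spec hex, fun i hi => Nat.find_min hex hi⟩
  refine le_trans ?_ (ENNReal.le_tsum j)
  rw [Set.indicator_of_mem (by rwa [Metric.mem_closedBall, Real.dist_eq])]
  apply ENNReal.ofReal_le_ofReal
  rw [← inv_inv (4 : ℝ), ← mul_inv, ← mul_inv, inv_inv]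
  apply inv_anti₀ (by positivity)
  cases j with
  | zero => nlinarith [sq_nonneg (t - E), sq_nonneg ε]
  | succ i =>
    have h1 : 2 ^ i * ε ≤ |t - E| := (not_le.mp (hmin i (Nat.lt_succ_self i))).le
    have h2 : (2 ^ i * ε) ^ 2 ≤ (t - E) ^ 2 := by
      rw [← sq_abs (t - E)]
      gcongr
    have h3 : (2 ^ i * ε) ^ 2 = 4 ^ i * ε ^ 2 := by
      rw [mul_pow, ← pow_mul, mul_comm i 2, pow_mul]
      norm_num
    rw [pow_succ]
    nlinarith [sq_nonneg ε]

/-- A uniform power bound for the measure of balls bounds the Poisson integral. -/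
theorem lintegral_poisson_le {μ : Measure ℝ} {E ε α η : ℝ} (hε : 0 < ε) (hα1 : α ≤ 1)
    (hη : 0 ≤ η) (h : ∀ r : ℝ, 0 < r → μ (Metric.closedBall E r) ≤ ENNReal.ofReal (η * r ^ α)) :
    ∫⁻ t, ENNReal.ofReal (((t - E) ^ 2 + ε ^ 2)⁻¹) ∂μ ≤
      ENNReal.ofReal (8 * η * ε ^ (α - 2)) := by
  calc ∫⁻ t, ENNReal.ofReal (((t - E) ^ 2 + ε ^ 2)⁻¹) ∂μ
      ≤ ∫⁻ t, ∑' j : ℕ, (Metric.closedBall E (2 ^ j * ε)).indicator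
        (fun _ => ENNReal.ofReal (4 * (4 ^ j)⁻¹ * (ε ^ 2)⁻¹)) t ∂μ :=
        lintegral_mono fun t => poisson_le_tsum_indicator hε t
    _ = ∑' j : ℕ, ENNReal.ofReal (4 * (4 ^ j)⁻¹ * (ε ^ 2)⁻¹) *
          μ (Metric.closedBall E (2 ^ j * ε)) := by
        rw [lintegral_tsum fun j =>
          (measurable_const.indicator Metric.isClosed_closedBall.measurableSet).aemeasurable]
        congr 1
        funext j
        rw [lintegral_indicator_const Metric.isClosed_closedBall.measurableSet]
    _ ≤ ∑' j : ℕ, ENNReal.ofReal (4 * η * ε ^ (α - 2) * (1 / 2) ^ j) := by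
        refine ENNReal.tsum_le_tsum fun j => ?_
        calc _ ≤ ENNReal.ofReal (4 * (4 ^ j)⁻¹ * (ε ^ 2)⁻¹) *
              ENNReal.ofReal (η * (2 ^ j * ε) ^ α) := by
              gcongr
              exact h _ (by positivity)
          _ = ENNReal.ofReal (4 * (4 ^ j)⁻¹ * (ε ^ 2)⁻¹ * (η * (2 ^ j * ε) ^ α)) :=
              (ENNReal.ofReal_mul (by positivity)).symm
          _ ≤ _ := by
              apply ENNReal.ofReal_le_ofReal
              -- Growth of the ball measures by at most `2 ^ j` against the decay `4 ^ (-j)` of the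
              -- kernel leaves a geometric series of ratio `1/2`.
              have h1 : ((2 : ℝ) ^ j) ^ α ≤ 2 ^ j := by
                conv_rhs => rw [← Real.rpow_one ((2 : ℝ) ^ j)]
                exact Real.rpow_le_rpow_of_exponent_le (one_le_pow₀ one_le_two) hα1
              have h2 : ε ^ (α - 2) = (ε ^ 2)⁻¹ * ε ^ α := by
                rw [Real.rpow_sub hε, Real.rpow_ofNat, div_eq_inv_mul]
              have h3 : ((4 : ℝ) ^ j)⁻¹ * 2 ^ j = (1 / 2) ^ j := by
                rw [← inv_pow, ← mul_pow]
                norm_num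
              rw [Real.mul_rpow (by positivity) hε.le, h2]
              calc 4 * ((4 : ℝ) ^ j)⁻¹ * (ε ^ 2)⁻¹ * (η * (((2 : ℝ) ^ j) ^ α * ε ^ α))
                  ≤ 4 * ((4 : ℝ) ^ j)⁻¹ * (ε ^ 2)⁻¹ * (η * ((2 : ℝ) ^ j * ε ^ α)) := by gcongr
                _ = 4 * η * ((ε ^ 2)⁻¹ * ε ^ α) * (((4 : ℝ) ^ j)⁻¹ * 2 ^ j) := by ring
                _ = _ := by rw [h3]
    _ = ENNReal.ofReal (8 * η * ε ^ (α - 2)) := by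
        rw [← ENNReal.ofReal_tsum_of_nonneg (fun j => by positivity)
          (summable_geometric_two.mul_left _), tsum_mul_left, tsum_geometric_two]
        congr 1
        ring

/-- Lower bounds for the Poisson integrals of a measure near `E` give lower bounds for the measure
of small balls around `E`. -/
theorem frequently_ball_of_frequently_poisson {μ : Measure ℝ} [IsFiniteMeasure μ] {E α : ℝ}
    (hα0 : 0 ≤ α) (hα1 : α ≤ 1)
    (h : ∃ c : ℝ, 0 < c ∧ ∃ᶠ k : ℕ in atTop,
      c ≤ (k : ℝ) ^ (α - 2) * ∫ t : ℝ, ‖((t : ℂ) - approachPt E k)⁻¹‖ ^ 2 ∂μ) :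
    ∃ η : ℝ, 0 < η ∧ ∀ δ : ℝ, 0 < δ → ∃ r : ℝ, 0 < r ∧ r < δ ∧
      ENNReal.ofReal (η * r ^ α) ≤ μ (Metric.closedBall E r) := by
  obtain ⟨c, hc, hfreq⟩ := h
  -- The part near `E` will contribute at most `8 * (c / 32) = c / 4` and the far part eventually
  -- less than `c / 2`, together less than `c`.
  refine ⟨c / 32, by positivity, ?_⟩
  by_contra! hcon
  obtain ⟨δ, hδ, hball⟩ := hcon
  set B := Metric.closedBall E (δ / 2) with hB
  have hBm : MeasurableSet B := Metric.isClosed_closedBall.measurableSet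
  -- Restriction to the ball of radius `δ / 2` extends the bound to all radii: for `r ≥ δ` the total
  -- restricted mass already satisfies it.
  have hball' : ∀ r : ℝ, 0 < r →
      μ.restrict B (Metric.closedBall E r) ≤ ENNReal.ofReal (c / 32 * r ^ α) := fun r hr => by
    by_cases hrδ : r < δ
    · exact (Measure.restrict_apply_le _ _).trans (hball r hr hrδ).le
    · calc μ.restrict B (Metric.closedBall E r) ≤ μ B := by
            rw [Measure.restrict_apply Metric.isClosed_closedBall.measurableSet]
            exact measure_mono Set.inter_subset_right
        _ ≤ ENNReal.ofReal (c / 32 * (δ / 2) ^ α) := (hball _ (by positivity) (by linarith)).le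
        _ ≤ _ := by
            apply ENNReal.ofReal_le_ofReal
            gcongr
            linarith
  set M := ((δ / 2) ^ 2)⁻¹ * μ.real Bᶜ with hM
  have hbound : ∀ k : ℕ, 0 < k → (k : ℝ) ^ (α - 2) *
      ∫ t : ℝ, ‖((t : ℂ) - approachPt E k)⁻¹‖ ^ 2 ∂μ ≤ c / 4 + (k : ℝ) ^ (α - 2) * M := by
    intro k hk
    have hk' : (0 : ℝ) < k := by exact_mod_cast hk
    simp only [approachPt, norm_inv_sub_sq]
    have hpos : ∀ t : ℝ, 0 ≤ ((t - E) ^ 2 + (k : ℝ)⁻¹ ^ 2)⁻¹ := fun t => by positivity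
    have hmeas : Measurable fun t : ℝ => ((t - E) ^ 2 + (k : ℝ)⁻¹ ^ 2)⁻¹ := by fun_prop
    have hint : Integrable (fun t : ℝ => ((t - E) ^ 2 + (k : ℝ)⁻¹ ^ 2)⁻¹) μ := by
      refine Integrable.of_bound hmeas.aestronglyMeasurable (((k : ℝ)⁻¹ ^ 2)⁻¹)
        (Eventually.of_forall fun t => ?_)
      rw [Real.norm_of_nonneg (hpos t)]
      apply inv_anti₀ (by positivity)
      linarith [sq_nonneg (t - E)]
    rw [← integral_add_compl hBm hint]
    have h1 : ∫ t in B, ((t - E) ^ 2 + (k : ℝ)⁻¹ ^ 2)⁻¹ ∂μ ≤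
        8 * (c / 32) * ((k : ℝ)⁻¹) ^ (α - 2) := by
      rw [integral_eq_lintegral_of_nonneg_ae (Eventually.of_forall hpos)
        hmeas.aestronglyMeasurable]
      exact ENNReal.toReal_le_of_le_ofReal (by positivity)
        (lintegral_poisson_le (inv_pos.mpr hk') hα1 (by positivity) hball')
    have h2 : ∫ t in Bᶜ, ((t - E) ^ 2 + (k : ℝ)⁻¹ ^ 2)⁻¹ ∂μ ≤ M := by
      refine (Real.le_norm_self _).trans (norm_setIntegral_le_of_norm_le_const
        (measure_lt_top _ _) fun t ht => ?_)
      rw [Real.norm_of_nonneg (hpos t)]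
      apply inv_anti₀ (by positivity)
      have h3 : δ / 2 ≤ |t - E| := by
        rw [Set.mem_compl_iff, hB, Metric.mem_closedBall, Real.dist_eq, not_le] at ht
        exact ht.le
      rw [← sq_abs (t - E)]
      have : (δ / 2) ^ 2 ≤ |t - E| ^ 2 := by gcongr
      linarith [sq_nonneg ((k : ℝ)⁻¹)]
    have h4 : (k : ℝ) ^ (α - 2) * ((k : ℝ)⁻¹) ^ (α - 2) = 1 := by
      rw [← Real.mul_rpow hk'.le (by positivity), mul_inv_cancel₀ hk'.ne', Real.one_rpow]
    calc _ ≤ (k : ℝ) ^ (α - 2) * (8 * (c / 32) * ((k : ℝ)⁻¹) ^ (α - 2) + M) := by gcongr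
      _ = 8 * (c / 32) * ((k : ℝ) ^ (α - 2) * ((k : ℝ)⁻¹) ^ (α - 2)) +
          (k : ℝ) ^ (α - 2) * M := by ring
      _ = _ := by
          rw [h4]
          ring
  have htend : Tendsto (fun k : ℕ => (k : ℝ) ^ (α - 2) * M) atTop (𝓝 0) := by
    have h1 : Tendsto (fun k : ℕ => (k : ℝ) ^ (-(2 - α))) atTop (𝓝 0) :=
      (tendsto_rpow_neg_atTop (by linarith)).comp tendsto_natCast_atTop_atTop
    simpa using h1.mul_const M
  have hev := (htend.eventually_lt_const (show (0 : ℝ) < c / 2 by positivity)).and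
    (eventually_gt_atTop 0)
  obtain ⟨k, hk1, hk2, hk3⟩ := (hfreq.and_eventually hev).exists
  have := hbound k hk3
  linarith

theorem ediam_closedBall_real_le (x r : ℝ) :
    Metric.ediam (Metric.closedBall x r) ≤ ENNReal.ofReal (2 * r) := by
  rw [Real.closedBall_eq_Icc, Real.ediam_Icc]
  apply ENNReal.ofReal_le_ofReal
  linarith

/-- A set of measure zero with uniformly positive upper density has Hausdorff measure zero. -/
theorem hausdorffMeasure_eq_zero_of_uniform_density {μ : Measure ℝ} [IsFiniteMeasure μ] {α η : ℝ}
    (hα0 : 0 ≤ α) (hη : 0 < η) {B : Set ℝ}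
    (h : ∀ E ∈ B, ∀ δ : ℝ, 0 < δ → ∃ r : ℝ, 0 < r ∧ r < δ ∧
      ENNReal.ofReal (η * r ^ α) ≤ μ (Metric.closedBall E r)) (hB : μ B = 0) :
    Measure.hausdorffMeasure α B = 0 := by
  -- A fivefold enlarged ball has diameter at most `10 r`, and `r ^ α` is at most `η⁻¹` times the
  -- measure of the original ball.
  set L : ℝ≥0∞ := ENNReal.ofReal (10 ^ α / η) with hL
  have hcover : ∀ n : ℕ, ∃ u : Set (ℝ × ℝ), u.Countable ∧
      (∀ p ∈ u, Metric.ediam (Metric.closedBall p.1 (5 * p.2)) ≤ ENNReal.ofReal (10 / (n + 1))) ∧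
      B ⊆ ⋃ p : u, Metric.closedBall p.1.1 (5 * p.1.2) ∧
      ∑' p : u, Metric.ediam (Metric.closedBall p.1.1 (5 * p.1.2)) ^ α ≤
        L * ENNReal.ofReal (1 / (n + 1)) := by
    intro n
    have hn : (0 : ℝ) < 1 / (n + 1) := by positivity
    obtain ⟨U, hBU, hUo, hU⟩ := Set.exists_isOpen_le_add B μ (ε := ENNReal.ofReal (1 / (n + 1)))
      (by simpa using hn)
    rw [hB, zero_add] at hU
    -- Balls of large measure inside an open set of measure at most `1 / (n + 1)`. A disjoint
    -- subfamily has total measure no larger than that, while its enlargements cover `B`. Outer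
    -- regularity needs no measurability of `B`.
    let t : Set (ℝ × ℝ) := {p | p.1 ∈ B ∧ 0 < p.2 ∧ p.2 < 1 / (n + 1) ∧
      Metric.closedBall p.1 p.2 ⊆ U ∧ ENNReal.ofReal (η * p.2 ^ α) ≤ μ (Metric.closedBall p.1 p.2)}
    obtain ⟨u, hut, hdisj, hcov⟩ := Vitali.exists_disjoint_subfamily_covering_enlargement_closedBall
      t Prod.fst Prod.snd (1 / (n + 1)) (fun p hp => hp.2.2.1.le) 5 (by norm_num)
    have hucount : u.Countable := hdisj.countable_of_nonempty_interior fun p hp => by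
      refine ⟨p.1, ?_⟩
      exact Metric.ball_subset_interior_closedBall (Metric.mem_ball_self (hut hp).2.1)
    have hdiam : ∀ p : ℝ × ℝ, Metric.ediam (Metric.closedBall p.1 (5 * p.2)) ≤
        ENNReal.ofReal (10 * p.2) := fun p => by
      refine (ediam_closedBall_real_le _ _).trans (le_of_eq ?_)
      congr 1
      ring
    refine ⟨u, hucount, fun p hp => (hdiam p).trans ?_, fun E hE => ?_, ?_⟩
    · apply ENNReal.ofReal_le_ofReal
      have := (hut hp).2.2.1.le
      rw [div_eq_mul_one_div]
      gcongr
    · obtain ⟨s, hs, hsU⟩ := Metric.isOpen_iff.mp hUo E (hBU hE)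
      obtain ⟨r, hr0, hr1, hr2⟩ := h E hE (min s (1 / (n + 1))) (lt_min hs hn)
      have hmem : (E, r) ∈ t := ⟨hE, hr0, hr1.trans_le (min_le_right _ _),
        (Metric.closedBall_subset_ball (hr1.trans_le (min_le_left _ _))).trans hsU, hr2⟩
      obtain ⟨q, hq, hsub⟩ := hcov _ hmem
      exact Set.mem_iUnion.mpr ⟨⟨q, hq⟩, hsub (Metric.mem_closedBall_self hr0.le)⟩
    · have : Countable u := hucount.to_subtype
      calc ∑' p : u, Metric.ediam (Metric.closedBall p.1.1 (5 * p.1.2)) ^ α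
          ≤ ∑' p : u, L * μ (Metric.closedBall p.1.1 p.1.2) := by
            refine ENNReal.tsum_le_tsum fun p => ?_
            have hp := hut p.2
            have hp0 : 0 < p.1.2 := hp.2.1
            calc Metric.ediam (Metric.closedBall p.1.1 (5 * p.1.2)) ^ α
                ≤ ENNReal.ofReal (10 * p.1.2) ^ α := ENNReal.rpow_le_rpow (hdiam p) hα0
              _ = ENNReal.ofReal (10 ^ α / η * (η * p.1.2 ^ α)) := by
                  rw [ENNReal.ofReal_rpow_of_pos (by positivity),
                    Real.mul_rpow (by norm_num) hp0.le]
                  congr 1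
                  field_simp
              _ = L * ENNReal.ofReal (η * p.1.2 ^ α) := ENNReal.ofReal_mul (by positivity)
              _ ≤ _ := by
                  gcongr
                  exact hp.2.2.2.2
        _ = L * μ (⋃ p : u, Metric.closedBall p.1.1 p.1.2) := by
            have hUn : μ (⋃ p : u, Metric.closedBall p.1.1 p.1.2) =
                ∑' p : u, μ (Metric.closedBall p.1.1 p.1.2) :=
              measure_iUnion
                (fun p q hpq => hdisj p.2 q.2 fun hcon => hpq (Subtype.ext hcon))
                fun p => Metric.isClosed_closedBall.measurableSet
            rw [ENNReal.tsum_mul_left, hUn]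
        _ ≤ L * μ U := by
            gcongr
            exact Set.iUnion_subset fun p => (hut p.2).2.2.2.1
        _ ≤ _ := by gcongr
  choose u hu1 hu2 hu3 hu4 using hcover
  have hcount : ∀ n, Countable (u n) := fun n => (hu1 n).to_subtype
  have hlim : ∀ C : ℝ, Tendsto (fun n : ℕ => ENNReal.ofReal (C / (n + 1))) atTop (𝓝 0) := fun C => by
    have h1 : Tendsto (fun n : ℕ => C / ((n : ℝ) + 1)) atTop (𝓝 0) := by
      simpa [div_eq_mul_inv] using (tendsto_one_div_add_atTop_nhds_zero_nat (𝕜 := ℝ)).const_mul C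
    simpa using ENNReal.tendsto_ofReal h1
  have h1 := Measure.hausdorffMeasure_le_liminf_tsum α B (l := atTop)
    (fun n : ℕ => ENNReal.ofReal (10 / (n + 1))) (hlim 10)
    (fun n (p : u n) => Metric.closedBall p.1.1 (5 * p.1.2))
    (Eventually.of_forall fun n p => hu2 n p p.2) (Eventually.of_forall hu3)
  have h2 : Tendsto (fun n : ℕ => L * ENNReal.ofReal (1 / (n + 1))) atTop (𝓝 0) := by
    simpa using ENNReal.Tendsto.const_mul (hlim 1) (Or.inr (ENNReal.ofReal_ne_top : L ≠ ∞))
  have h3 : liminf (fun n : ℕ => ∑' p : u n,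
      Metric.ediam (Metric.closedBall p.1.1 (5 * p.1.2)) ^ α) atTop ≤ 0 := by
    rw [← h2.liminf_eq]
    exact liminf_le_liminf (Eventually.of_forall hu4)
  exact le_antisymm (h1.trans h3) zero_le

/-- A set of measure zero along which the Poisson integrals are large is null for the Hausdorff
measure. -/
theorem hausdorffMeasure_eq_zero_of_poisson {μ : Measure ℝ} [IsFiniteMeasure μ] {α : ℝ}
    (hα0 : 0 ≤ α) (hα1 : α ≤ 1) {B : Set ℝ}
    (h : ∀ E ∈ B, ∃ c : ℝ, 0 < c ∧ ∃ᶠ k : ℕ in atTop,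
      c ≤ (k : ℝ) ^ (α - 2) * ∫ t : ℝ, ‖((t : ℂ) - approachPt E k)⁻¹‖ ^ 2 ∂μ)
    (hB : μ B = 0) : Measure.hausdorffMeasure α B = 0 := by
  -- The density constant depends on the point, so `B` is split into countably many pieces on which
  -- it is uniform.
  let D : ℕ → Set ℝ := fun n => {E ∈ B | ∀ δ : ℝ, 0 < δ → ∃ r : ℝ, 0 < r ∧ r < δ ∧
      ENNReal.ofReal (1 / (n + 1) * r ^ α) ≤ μ (Metric.closedBall E r)}
  have hD : B ⊆ ⋃ n, D n := fun E hE => by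
    obtain ⟨η, hη, hr⟩ := frequently_ball_of_frequently_poisson hα0 hα1 (h E hE)
    obtain ⟨n, hn⟩ := exists_nat_one_div_lt hη
    refine Set.mem_iUnion.mpr ⟨n, hE, fun δ hδ => ?_⟩
    obtain ⟨r, hr0, hr1, hr2⟩ := hr δ hδ
    refine ⟨r, hr0, hr1, le_trans (ENNReal.ofReal_le_ofReal ?_) hr2⟩
    gcongr
  refine measure_mono_null hD (measure_iUnion_null fun n => ?_)
  exact hausdorffMeasure_eq_zero_of_uniform_density hα0 (η := 1 / (n + 1)) (by positivity)
    (fun E hE => hE.2) (measure_mono_null (fun E hE => hE.1) hB)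

end HausdorffDensity
-- One vector with random phases in place of all the `δ_n`.
section GenericVector

variable {H : Type*} [NormedAddCommGroup H] [InnerProductSpace ℂ H]

/-- The weighted squared norms of the vectors `T_k(E) φ` do not tend to zero. -/
def IsLargeAt (w : ℕ → ℝ) (T : ℕ → ℝ → H →L[ℂ] H) (E : ℝ) (φ : H) : Prop :=
  ∃ c : ℝ, 0 < c ∧ ∃ᶠ k : ℕ in atTop, c ≤ w k * ‖T k E φ‖ ^ 2

variable {w : ℕ → ℝ} {T : ℕ → ℝ → H →L[ℂ] H}

/-- The vectors at which there is no largeness form a linear subspace. -/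
theorem isLargeAt_or_of_smul_sub (hw : ∀ k, 0 ≤ w k) {E : ℝ} {φ ψ : H} {a : ℂ}
    (h : IsLargeAt w T E (a • (φ - ψ))) : IsLargeAt w T E φ ∨ IsLargeAt w T E ψ := by
  obtain ⟨c, hc, hfreq⟩ := h
  -- If both vectors were below `c / C`, the parallelogram-type bound `2x² + 2y²` would put the
  -- multiple of the difference below `c`. The `+ 1` keeps `C` positive when `a = 0`.
  set C := 4 * (‖a‖ ^ 2 + 1) with hC
  have hC0 : 0 < C := by positivity
  have hstep : ∃ᶠ k : ℕ in atTop,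
      c / C ≤ w k * ‖T k E φ‖ ^ 2 ∨ c / C ≤ w k * ‖T k E ψ‖ ^ 2 := by
    refine hfreq.mono fun k hk => ?_
    by_contra! hcon
    obtain ⟨h1, h2⟩ := hcon
    rw [map_smul, map_sub, norm_smul, mul_pow] at hk
    have h3 : ‖T k E φ - T k E ψ‖ ^ 2 ≤ 2 * ‖T k E φ‖ ^ 2 + 2 * ‖T k E ψ‖ ^ 2 := by
      have := norm_sub_le (T k E φ) (T k E ψ)
      calc ‖T k E φ - T k E ψ‖ ^ 2 ≤ (‖T k E φ‖ + ‖T k E ψ‖) ^ 2 := by gcongr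
        _ ≤ _ := by nlinarith [sq_nonneg (‖T k E φ‖ - ‖T k E ψ‖)]
    rw [lt_div_iff₀ hC0] at h1 h2
    have h4 : w k * (‖a‖ ^ 2 * ‖T k E φ - T k E ψ‖ ^ 2) ≤
        w k * ((‖a‖ ^ 2 + 1) * (2 * ‖T k E φ‖ ^ 2 + 2 * ‖T k E ψ‖ ^ 2)) := by
      have := hw k
      gcongr
      linarith
    rw [hC] at h1 h2
    nlinarith
  rcases frequently_or_distrib.mp hstep with h1 | h1
  · exact Or.inl ⟨c / C, by positivity, h1⟩
  · exact Or.inr ⟨c / C, by positivity, h1⟩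

/-- With the constants `c` replaced by `1 / (m + 1)`, this is a countable union of upper limits of
closed sets. Joint measurability in the parameter and the energy is what Fubini requires; the strict
`N < k` excludes `k = 0`, where no continuity is assumed. -/
theorem measurableSet_isLargeAt {X : Type*} [TopologicalSpace X] [SecondCountableTopology X]
    [MeasurableSpace X] [BorelSpace X] (hT : ∀ k, 0 < k → Continuous (T k)) {φ : X → H}
    (hφ : Continuous φ) : MeasurableSet {p : X × ℝ | IsLargeAt w T p.2 (φ p.1)} := by
  have hset : {p : X × ℝ | IsLargeAt w T p.2 (φ p.1)} = ⋃ m : ℕ, ⋂ N : ℕ, ⋃ k : ℕ, ⋃ _ : N < k,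
      {p : X × ℝ | 1 / ((m : ℝ) + 1) ≤ w k * ‖T k p.2 (φ p.1)‖ ^ 2} := by
    ext p
    simp only [Set.mem_iUnion, Set.mem_iInter, Set.mem_ofPred_eq, IsLargeAt, exists_prop]
    constructor
    · rintro ⟨c, hc, hfreq⟩
      obtain ⟨m, hm⟩ := exists_nat_one_div_lt hc
      refine ⟨m, fun N => ?_⟩
      obtain ⟨k, hk1, hk2⟩ := (hfreq.and_eventually (eventually_gt_atTop N)).exists
      exact ⟨k, hk2, hm.le.trans hk1⟩
    · rintro ⟨m, hm⟩
      refine ⟨1 / ((m : ℝ) + 1), by positivity, frequently_atTop.mpr fun N => ?_⟩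
      obtain ⟨k, hk1, hk2⟩ := hm N
      exact ⟨k, hk1.le, hk2⟩
  rw [hset]
  refine MeasurableSet.iUnion fun m => MeasurableSet.iInter fun N => MeasurableSet.iUnion fun k =>
    MeasurableSet.iUnion fun hk => ?_
  have hc : Continuous fun p : X × ℝ => T k p.2 (φ p.1) :=
    ((hT k (by omega)).comp continuous_snd).clm_apply (hφ.comp continuous_fst)
  exact (isClosed_le continuous_const (continuous_const.mul (hc.norm.pow 2))).measurableSet

instance infinite_unitAddCircle : Infinite UnitAddCircle := by
  have : Infinite (Set.Ico (0 : ℝ) (0 + 1)) := (Set.Ico_infinite (by norm_num)).to_subtype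
  exact Infinite.of_injective _ (AddCircle.equivIco (1 : ℝ) 0).symm.injective

variable {ι : Type*}

/-- The vector with coefficients `a_i` and phases `ω_i` in the system `e_i`. -/
noncomputable def phaseVector (a : ι → ℝ) (e : ι → H) (ω : ι → UnitAddCircle) : H :=
  ∑' i, ((a i : ℂ) * AddCircle.toCircle (ω i)) • e i

theorem norm_phase_le {a : ι → ℝ} (ha : ∀ i, 0 < a i) {e : ι → H} (he : ∀ i, ‖e i‖ ≤ 1)
    (i : ι) (ω : ι → UnitAddCircle) :
    ‖((a i : ℂ) * AddCircle.toCircle (ω i)) • e i‖ ≤ a i := by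
  rw [norm_smul, norm_mul, Circle.norm_coe, mul_one, Complex.norm_real,
    Real.norm_of_nonneg (ha i).le]
  exact mul_le_of_le_one_right (ha i).le (he i)

variable [CompleteSpace H]

theorem continuous_phaseVector {a : ι → ℝ} (ha : ∀ i, 0 < a i) (hsum : Summable a) {e : ι → H}
    (he : ∀ i, ‖e i‖ ≤ 1) : Continuous (phaseVector a e) := by
  refine continuous_tsum (fun i => ?_) hsum (norm_phase_le ha he)
  have h1 : Continuous fun ω : ι → UnitAddCircle => ((AddCircle.toCircle (ω i) : Circle) : ℂ) :=
    continuous_subtype_val.comp (AddCircle.continuous_toCircle.comp (continuous_apply i))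
  exact (continuous_const.mul h1).smul continuous_const

theorem phaseVector_sub [DecidableEq ι] {a : ι → ℝ} (ha : ∀ i, 0 < a i) (hsum : Summable a)
    {e : ι → H} (he : ∀ i, ‖e i‖ ≤ 1) (i : ι) (θ θ' : UnitAddCircle) (ω : ι → UnitAddCircle) :
    phaseVector a e (Pi.single i θ + ω) - phaseVector a e (Pi.single i θ' + ω) =
      ((a i : ℂ) * (AddCircle.toCircle (θ + ω i) - AddCircle.toCircle (θ' + ω i))) • e i := by
  have hs : ∀ ω : ι → UnitAddCircle, Summable fun j =>
      ((a j : ℂ) * AddCircle.toCircle (ω j)) • e j := fun ω =>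
    Summable.of_norm_bounded hsum fun j => norm_phase_le ha he j ω
  unfold phaseVector
  rw [← (hs _).tsum_sub (hs _), tsum_eq_single i]
  · rw [← sub_smul]
    congr 1
    simp only [Pi.add_apply, Pi.single_eq_same]
    ring
  · intro j hj
    simp [Pi.single_eq_of_ne hj]

/-- If `e_i` is large at `E`, then so is almost every vector with random phases. -/
theorem addHaar_not_isLargeAt [Countable ι] (hw : ∀ k, 0 ≤ w k)
    (hT : ∀ k, 0 < k → Continuous (T k)) {a : ι → ℝ} (ha : ∀ i, 0 < a i) (hsum : Summable a)
    {e : ι → H} (he : ∀ i, ‖e i‖ ≤ 1) {E : ℝ} {i : ι} (hi : IsLargeAt w T E (e i)) :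
    (Measure.addHaar : Measure (ι → UnitAddCircle))
      {ω | ¬ IsLargeAt w T E (phaseVector a e ω)} = 0 := by
  classical
  set P : Measure (ι → UnitAddCircle) := Measure.addHaar with hP
  set B := {ω : ι → UnitAddCircle | ¬ IsLargeAt w T E (phaseVector a e ω)} with hB
  have hBm : MeasurableSet B := by
    have h1 := (measurableSet_isLargeAt (w := w) hT (continuous_phaseVector ha hsum he)).compl
    exact (measurable_id.prodMk measurable_const : Measurable fun ω => (ω, E)) h1
  -- Translates of the bad set by infinitely many different phases in the coordinate `i`. They have
  -- equal Haar measure; a common point would exhibit `e i` as a multiple of the difference of two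
  -- non-large vectors. Disjointness and finite total measure force measure zero.
  let A : ℕ → Set (ι → UnitAddCircle) := fun n =>
    (fun ω => Pi.single i (Infinite.natEmbedding UnitAddCircle n) + ω) ⁻¹' B
  have hA : ∀ n, P (A n) = P B := fun n => measure_preimage_add P _ B
  have hAm : ∀ n, MeasurableSet (A n) := fun n => measurable_const_add _ hBm
  have hdisj : Pairwise (Function.onFun Disjoint A) := by
    intro m n hmn
    rw [Function.onFun, Set.disjoint_left]
    intro ω hm hn
    set θ := Infinite.natEmbedding UnitAddCircle m
    set θ' := Infinite.natEmbedding UnitAddCircle n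
    have hne : θ ≠ θ' := fun h => hmn ((Infinite.natEmbedding UnitAddCircle).injective h)
    have hs : (a i : ℂ) * (AddCircle.toCircle (θ + ω i) - AddCircle.toCircle (θ' + ω i)) ≠ 0 := by
      refine mul_ne_zero (by exact_mod_cast (ha i).ne') (sub_ne_zero.mpr fun h => hne ?_)
      exact add_right_cancel (AddCircle.injective_toCircle one_ne_zero (Circle.ext h))
    have h1 := phaseVector_sub ha hsum he i θ θ' ω
    have h2 : e i = ((a i : ℂ) * (AddCircle.toCircle (θ + ω i) -
        AddCircle.toCircle (θ' + ω i)))⁻¹ • (phaseVector a e (Pi.single i θ + ω) -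
        phaseVector a e (Pi.single i θ' + ω)) := by
      rw [h1, inv_smul_smul₀ hs]
    rw [h2] at hi
    rcases isLargeAt_or_of_smul_sub hw hi with h | h
    · exact hm h
    · exact hn h
  by_contra hne
  have h1 : P (⋃ n, A n) = ∞ := by
    rw [measure_iUnion hdisj hAm]
    simp_rw [hA]
    exact ENNReal.tsum_const_eq_top_of_ne_zero hne
  exact measure_ne_top P _ h1

/-- There is one vector which is large at almost all points where some `e_i` is. -/
theorem exists_generic_vector [Countable ι] (hw : ∀ k, 0 ≤ w k)
    (hT : ∀ k, 0 < k → Continuous (T k)) {e : ι → H} (he : ∀ i, ‖e i‖ ≤ 1)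
    (μ : ι → Measure ℝ) [∀ i, IsFiniteMeasure (μ i)] :
    ∃ φ : H, ∀ i, μ i {E | IsLargeAt w T E (e i) ∧ ¬ IsLargeAt w T E φ} = 0 := by
  have := Encodable.ofCountable ι
  obtain ⟨a, ha, c, hsum, -⟩ := posSumOfEncodable one_pos ι
  have hcont := continuous_phaseVector ha hsum.summable he
  set P : Measure (ι → UnitAddCircle) := Measure.addHaar with hP
  have key : ∀ i, ∀ᵐ ω ∂P,
      μ i {E | IsLargeAt w T E (e i) ∧ ¬ IsLargeAt w T E (phaseVector a e ω)} = 0 := fun i => by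
    let s : Set ((ι → UnitAddCircle) × ℝ) :=
      {p | IsLargeAt w T p.2 (e i)} ∩ {p | IsLargeAt w T p.2 (phaseVector a e p.1)}ᶜ
    have hs : MeasurableSet s :=
      (measurableSet_isLargeAt (φ := fun _ => e i) hT continuous_const).inter
        (measurableSet_isLargeAt hT hcont).compl
    -- For each fixed energy the section in the phases is null; Fubini then exchanges the roles of
    -- phases and energy.
    have h0 : (P.prod (μ i)) s = 0 := by
      rw [Measure.prod_apply_symm hs]
      refine (lintegral_congr fun E => ?_).trans lintegral_zero
      by_cases hE : IsLargeAt w T E (e i)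
      · exact measure_mono_null (fun ω hω => hω.2) (addHaar_not_isLargeAt hw hT ha hsum.summable he hE)
      · exact measure_mono_null (fun ω hω => (hE hω.1).elim) measure_empty
    exact Measure.measure_ae_null_of_prod_null h0
  obtain ⟨ω, hω⟩ := (ae_all_iff.mpr key).exists
  exact ⟨phaseVector a e ω, hω⟩

end GenericVector
-- Continuity in the energy, essential supports, and the conclusion.
theorem continuous_approachPt (k : ℕ) : Continuous fun E : ℝ => approachPt E k := by
  unfold approachPt
  fun_prop

theorem continuous_schrodingerResAt {d : ℕ} (Ω : Set (Fin d → ℤ)) (v : Ω → ℝ) {k : ℕ}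
    (hk : 0 < k) : Continuous fun E : ℝ => schrodingerResAt Ω v (approachPt E k) := by
  rw [continuous_iff_continuousAt]
  intro E
  have hz : (approachPt E k).im ≠ 0 := by
    rw [approachPt_im]
    have : (0 : ℝ) < k := by exact_mod_cast hk
    positivity
  exact ContinuousAt.comp (f := fun E : ℝ => approachPt E k)
    ((isResolventAtI_schrodingerRes Ω v).continuousAt hz) (continuous_approachPt k).continuousAt

/-- If `μ` charges every subset of `S` of positive Lebesgue measure, then `S` is an essential
support of the absolutely continuous part of `μ` on `S`. -/
theorem isEssentialSupport_acPart {μ : Measure ℝ} [SigmaFinite μ] {S : Set ℝ}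
    (hS : MeasurableSet S) (h : ∀ S₁ ⊆ S, 0 < (volume : Measure ℝ) S₁ → 0 < μ S₁) :
    IsEssentialSupport ((acPart μ).restrict S) S := by
  constructor
  · rw [Measure.restrict_apply hS.compl]
    simp
  · intro T hT hTS hν
    rw [Measure.restrict_apply hT, Set.inter_eq_self_of_subset_left hTS] at hν
    -- `N` has full Lebesgue measure and no singular mass, so on `T ∩ N` the measure `μ` agrees with
    -- its absolutely continuous part and nothing of the Lebesgue measure of `T` is lost.
    obtain ⟨N, hN, hN1, hN2⟩ := μ.mutuallySingular_singularPart volume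
    by_contra hvol
    have h1 : 0 < (volume : Measure ℝ) (T ∩ N) := by
      refine pos_iff_ne_zero.mpr fun h0 => hvol ?_
      refine measure_mono_null (t := (T ∩ N) ∪ Nᶜ) (fun x hx => ?_) (measure_union_null h0 hN2)
      exact (em (x ∈ N)).imp (fun hxN => ⟨hx, hxN⟩) id
    refine (h _ (Set.inter_subset_left.trans hTS) h1).ne' ?_
    rw [μ.haveLebesgueDecomposition_add volume, Measure.add_apply,
      measure_mono_null Set.inter_subset_right hN1, zero_add]
    exact measure_mono_null Set.inter_subset_left hν

end DiscreteSchrodinger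

open DiscreteSchrodinger in
theorem theorem3p2 (d : ℕ) (Ω : Set (Fin d → ℤ)) (hΩinf : Ω.Infinite)
    (hΩconn : (DiscreteSchrodinger.domainGraph Ω).Connected)
    (v : Ω → ℝ) (α : ℝ) (hα0 : 0 ≤ α) (hα1 : α ≤ 1)
    (S : Set ℝ) (hSmeas : MeasurableSet S) (hSpos : 0 < Measure.hausdorffMeasure α S)
    (hsol : ∀ E ∈ S, ∃ u : Ω → ℂ,
      DiscreteSchrodinger.IsNontrivialSolution Ω v E u ∧
        DiscreteSchrodinger.HasSlowGrowth Ω α u) :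
    ∃ (φ : DiscreteSchrodinger.ellTwo Ω) (μ : Measure ℝ),
      DiscreteSchrodinger.IsSpectralMeasure (DiscreteSchrodinger.schrodingerOp Ω v) φ μ ∧
        (∀ S₁ : Set ℝ, S₁ ⊆ S → 0 < Measure.hausdorffMeasure α S₁ → 0 < μ S₁) ∧
        (α = 1 →
          DiscreteSchrodinger.IsEssentialSupport
            ((DiscreteSchrodinger.acPart μ).restrict S) S) := by
  let T : ℕ → ℝ → ellTwo Ω →L[ℂ] ellTwo Ω := fun k E => schrodingerResAt Ω v (approachPt E k)
  let w : ℕ → ℝ := fun k => (k : ℝ) ^ (α - 2)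
  choose m hm hnorm using exists_isSpectralMeasure Ω v
  have hfin : ∀ φ, IsFiniteMeasure (m φ) := fun φ => (hm φ).1
  let e : Ω → ellTwo Ω := fun n => lp.single 2 n 1
  obtain ⟨φ, hφ⟩ := exists_generic_vector (w := w) (T := T) (fun k => by positivity)
    (fun k hk => continuous_schrodingerResAt Ω v hk) (e := e)
    (fun n => by rw [lp.norm_single (by simp)]; simp) (fun n => m (e n))
  have hnull : ∀ (ψ : ellTwo Ω) (B : Set ℝ), (∀ E ∈ B, IsLargeAt w T E ψ) → m ψ B = 0 →
      Measure.hausdorffMeasure α B = 0 := fun ψ B hB hB0 => by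
    refine hausdorffMeasure_eq_zero_of_poisson hα0 hα1 (fun E hE => ?_) hB0
    obtain ⟨c, hc, hfreq⟩ := hB E hE
    refine ⟨c, hc, (hfreq.and_eventually (eventually_gt_atTop 0)).mono ?_⟩
    rintro k ⟨h1, hk⟩
    rw [← hnorm ψ _ (by
      rw [approachPt_im]
      have : (0 : ℝ) < k := by exact_mod_cast hk
      positivity)]
    exact h1
  have hmain : ∀ S₁ : Set ℝ, S₁ ⊆ S → 0 < Measure.hausdorffMeasure α S₁ → 0 < m φ S₁ := by
    intro S₁ hS₁ hpos
    by_contra hcon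
    have h0 : m φ S₁ = 0 := by simpa using hcon
    -- Two kinds of points with different dominating measures: where `φ` is large, the assumed
    -- nullity for the measure of `φ` is used; where only some `δ_n` is large, genericity gives
    -- nullity for the measure of that `δ_n`. The density argument makes both sets `h^α`-null.
    refine hpos.ne' (measure_mono_null (t := (S₁ ∩ {E | IsLargeAt w T E φ}) ∪
      ⋃ n, {E | IsLargeAt w T E (e n) ∧ ¬ IsLargeAt w T E φ}) ?_ ?_)
    · intro E hE
      by_cases hL : IsLargeAt w T E φ
      · exact Or.inl ⟨hE, hL⟩
      · obtain ⟨u, ⟨hu0, hu⟩, hs⟩ := hsol E (hS₁ hE)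
        obtain ⟨n, hn⟩ := Function.ne_iff.mp hu0
        exact Or.inr (Set.mem_iUnion.mpr ⟨n, resolvent_lower_bound hα0 hu hs hn, hL⟩)
    · refine measure_union_null ?_ (measure_iUnion_null fun n => ?_)
      · exact hnull φ _ (fun E hE => hE.2) (measure_mono_null Set.inter_subset_left h0)
      · exact hnull (e n) _ (fun E hE => hE.1) (hφ n)
  refine ⟨φ, m φ, hm φ, hmain, fun h1 => isEssentialSupport_acPart hSmeas fun S₁ hS₁ hpos => ?_⟩
  refine hmain S₁ hS₁ ?_
  rw [h1, hausdorffMeasure_real]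
  exact hpos
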